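/- Let $N, d \ge 0$ be integers and let $\mathcal P_{N,d} = H^0(\mathbb P^N, \mathcal O_{\mathbb P^N}(d))$ be the complex vector space of homogeneous polynomials of degree $d$ in $x_0,\dots,x_N$ with coefficients in $\mathbb C$ (zero included), with its Zariski topology. For $f \in \mathcal P_{N,d}$ let $$\mathrm{Sing}(f) = \Bigl\{p \in \mathbb P^N \;:\; f(p) = 0 \text{ and } \frac{\partial f}{\partial x_i}(p) = 0 \text{ for all } i = 0,\dots,N\Bigr\}$$ be the set of singular points of the hypersurface $\{f=0\} \subset \mathbb P^N$ (so $\mathrm{Sing}(0) = \mathbb P^N$). Then the set $$\mathcal P^{(1)}_{N,d} = \{f \in \mathcal P_{N,d} : \dim \mathrm{Sing}(f) \ge 1\}$$ is Zariski closed in $\mathcal P_{N,d}$, and $$\mathrm{codim}\bigl(\mathcal P^{(1)}_{N,d} \subset \mathcal P_{N,d}\bigr) \ge (d-2)N.$$ (The codimension of the empty set is $+\infty$.) -/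

import Mathlib

open MvPolynomial TopologicalSpace

/-- The projective space `ℙ^N` over `ℂ`, as the set of lines in `ℂ^(N+1)`. -/
def ProjSpace (N : ℕ) : Type := Projectivization ℂ (Fin (N + 1) → ℂ)

/-- The polynomial `g` vanishes at the homogeneous coordinates of `p`. It is used for homogeneous
`g` only, where it does not depend on the choice of the coordinates
(`vanishesAt_mk_iff`). -/
def VanishesAt {N : ℕ} (g : MvPolynomial (Fin (N + 1)) ℂ) (p : ProjSpace N) : Prop :=
  eval (Projectivization.rep p) g = 0

theorem vanishesAt_mk_iff {N n : ℕ} {g : MvPolynomial (Fin (N + 1)) ℂ} (hg : g.IsHomogeneous n)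
    (v : Fin (N + 1) → ℂ) (hv : v ≠ 0) :
    VanishesAt g (Projectivization.mk ℂ v hv : ProjSpace N) ↔ eval v g = 0 := by
  obtain ⟨a, ha⟩ := Projectivization.exists_smul_eq_mk_rep ℂ v hv
  have h : eval ((a : ℂ) • v) g = (a : ℂ) ^ n * eval v g := by
    rw [eval_eq, eval_eq, Finset.mul_sum]
    refine Finset.sum_congr rfl fun m hm => ?_
    have hm' : ∑ i ∈ m.support, m i = n := by
      have := hg (mem_support_iff.1 hm)
      rw [Finsupp.weight_apply, Finsupp.sum] at this
      simpa using this
    simp only [Pi.smul_apply, smul_eq_mul, mul_pow, Finset.prod_mul_distrib,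
      Finset.prod_pow_eq_pow_sum, hm']
    ring
  unfold VanishesAt
  rw [← ha]
  change eval ((a : ℂ) • v) g = 0 ↔ _
  rw [h]
  simp

/-- The common zeros in `ℙ^N` of a set of polynomials. -/
def projZeros {N : ℕ} (S : Set (MvPolynomial (Fin (N + 1)) ℂ)) : Set (ProjSpace N) :=
  {p | ∀ g ∈ S, VanishesAt g p}

/-- The Zariski topology on `ℙ^N`: the closed sets are the common zeros of sets of homogeneous
polynomials (of arbitrary degrees). -/
instance ProjSpace.zariskiTopology (N : ℕ) : TopologicalSpace (ProjSpace N) :=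
  TopologicalSpace.ofClosed
    {Z | ∃ S : Set (MvPolynomial (Fin (N + 1)) ℂ),
      (∀ g ∈ S, ∃ n, g.IsHomogeneous n) ∧ Z = projZeros S}
    ⟨{1}, by simpa using ⟨0, isHomogeneous_one _ _⟩, by
      ext p; simp [projZeros, VanishesAt]⟩
    (by
      intro A hA
      have hA' : ∀ Z ∈ A, ∃ S : Set (MvPolynomial (Fin (N + 1)) ℂ),
          (∀ g ∈ S, ∃ n, g.IsHomogeneous n) ∧ Z = projZeros S := fun Z h => hA h
      choose! T hT hZ using hA'
      refine ⟨⋃ Z ∈ A, T Z, ?_, ?_⟩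
      · simp only [Set.mem_iUnion]
        rintro g ⟨Z, hZA, hg⟩
        exact hT Z hZA g hg
      · ext p
        simp only [Set.mem_sInter, projZeros, Set.mem_iUnion, Set.mem_ofPred_eq]
        constructor
        · rintro h g ⟨Z, hZA, hg⟩
          have := h Z hZA
          rw [hZ Z hZA] at this
          exact this g hg
        · intro h Z hZA
          rw [hZ Z hZA]
          exact fun g hg => h g ⟨Z, hZA, hg⟩)
    (by
      rintro _ ⟨S, hS, rfl⟩ _ ⟨T, hT, rfl⟩
      refine ⟨{x | ∃ g ∈ S, ∃ h ∈ T, x = g * h}, ?_, ?_⟩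
      · rintro _ ⟨g, hg, h, hh, rfl⟩
        obtain ⟨m, hm⟩ := hS g hg
        obtain ⟨n, hn⟩ := hT h hh
        exact ⟨m + n, hm.mul hn⟩
      · ext p
        simp only [projZeros, VanishesAt, Set.mem_union, Set.mem_ofPred_eq]
        constructor
        · rintro (h | h) _ ⟨g, hg, k, hk, rfl⟩
          · simp [h g hg]
          · simp [h k hk]
        · intro h
          by_contra! hc
          obtain ⟨⟨g, hg, hg0⟩, k, hk, hk0⟩ := hc
          have := h _ ⟨g, hg, k, hk, rfl⟩
          rw [map_mul, mul_eq_zero] at this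
          tauto)

/-- The space `H⁰(ℙ^N, 𝒪(d))` of homogeneous polynomials of degree `d` (zero included) in the
`N + 1` variables `x_0, …, x_N` over `ℂ`. -/
abbrev Forms (N d : ℕ) : Type := homogeneousSubmodule (Fin (N + 1)) ℂ d

/-- The common zeros in `Forms N d` of a set of polynomials in the coefficients of the form. The
variables are indexed by all monomials; those of degree other than `d` have coefficient `0` in
every element of `Forms N d`. -/
def coeffZeros {N d : ℕ} (S : Set (MvPolynomial (Fin (N + 1) →₀ ℕ) ℂ)) : Set (Forms N d) :=
  {f | ∀ F ∈ S, eval (fun m => coeff m (f : MvPolynomial (Fin (N + 1)) ℂ)) F = 0}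

/-- The Zariski topology on the finite-dimensional vector space `Forms N d`: the closed sets are
those given by polynomial equations in the coefficients. -/
instance Forms.zariskiTopology (N d : ℕ) : TopologicalSpace (Forms N d) :=
  TopologicalSpace.ofClosed {Z | ∃ S, Z = coeffZeros S}
    ⟨{1}, by ext f; simp [coeffZeros]⟩
    (by
      intro A hA
      have hA' : ∀ Z ∈ A, ∃ S, Z = coeffZeros S := fun Z h => hA h
      choose! T hZ using hA'
      refine ⟨⋃ Z ∈ A, T Z, ?_⟩
      ext f
      simp only [Set.mem_sInter, coeffZeros, Set.mem_iUnion, Set.mem_ofPred_eq]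
      constructor
      · rintro h g ⟨Z, hZA, hg⟩
        have := h Z hZA
        rw [hZ Z hZA] at this
        exact this g hg
      · intro h Z hZA
        rw [hZ Z hZA]
        exact fun g hg => h g ⟨Z, hZA, hg⟩)
    (by
      rintro _ ⟨S, rfl⟩ _ ⟨T, rfl⟩
      refine ⟨{x | ∃ g ∈ S, ∃ h ∈ T, x = g * h}, ?_⟩
      ext f
      simp only [coeffZeros, Set.mem_union, Set.mem_ofPred_eq]
      constructor
      · rintro (h | h) _ ⟨g, hg, k, hk, rfl⟩
        · simp [h g hg]
        · simp [h k hk]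
      · intro h
        by_contra! hc
        obtain ⟨⟨g, hg, hg0⟩, k, hk, hk0⟩ := hc
        have := h _ ⟨g, hg, k, hk, rfl⟩
        rw [map_mul, mul_eq_zero] at this
        tauto)

/-- The set of singular points of the hypersurface `{f = 0}` in `ℙ^N`: the points of the
hypersurface at which all partial derivatives of `f` vanish. For `f = 0` it is all of `ℙ^N`. -/
def Sing {N d : ℕ} (f : Forms N d) : Set (ProjSpace N) :=
  {p | VanishesAt (f : MvPolynomial (Fin (N + 1)) ℂ) p ∧
    ∀ i, VanishesAt (pderiv i (f : MvPolynomial (Fin (N + 1)) ℂ)) p}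

/-- The set of forms `f` of degree `d` such that `{f = 0}` has a singular set of dimension at least
`i`; the dimension is that of the Zariski topology, with `dim ∅ = -∞`. -/
def SingDimGE (i N d : ℕ) : Set (Forms N d) :=
  {f | (i : WithBot ℕ∞) ≤ topologicalKrullDim (Sing f)}

/-- The codimension of a closed subset `S` of a topological space `X`: the infimum, over the
irreducible closed subsets `Z` of `S`, of the supremum of the lengths of chains
`Z = Z₀ ⊂ Z₁ ⊂ ⋯ ⊂ Z_n` of irreducible closed subsets of `X`. It is `⊤` for `S = ∅`. -/
noncomputable def topCodim {X : Type*} [TopologicalSpace X] (S : Set X) : ℕ∞ :=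
  ⨅ (Z : IrreducibleCloseds X) (_ : (Z : Set X) ⊆ S), Order.coheight Z

/-!
A hypersurface has a singular set of positive dimension if and only if every hyperplane contains a
singular point (`mem_singDimGE_one_iff`). For a fixed hyperplane this is a closed condition by
elimination theory (`exists_eliminant`), so the set in question is closed.

For the codimension, let `Z` be an irreducible closed subset and `c` its generic point, that is, a
vector of coefficients in an algebraically closed field `Ω` whose specializations make up `Z`
(`exists_eq_genericClosed`). A chain above `Z` arises by replacing the coefficients that are
algebraic over the others by indeterminates, one after the other. Hence the codimension of `Z` is
at least the number `M` of monomials minus the transcendence degree of `c`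
(`card_compl_le_coheight_genericClosed`), and the transcendence degree is at most the dimension of
the space of all forms `D f`, where `f` is the generic form and a derivation `D` of `Ω` over `ℂ`
acts on its coefficients (`ncard_le_finrank_range_derivativeMap`). It remains to show that this
space of first-order deformations has dimension at most `M - (d - 2) N`
(`finrank_range_derivativeMap_le`).

The singular set of `f` is infinite, so it has a nonconstant point `ξ` with coordinates in an
extension field `F` of `Ω` (`exists_nonconstant_zero`). Differentiating `f(ξ) = 0` gives
`(D f)(ξ) = 0`, because the partial derivatives of `f` vanish at `ξ`. So the deformations lie in
the kernel of the evaluation at `ξ`, whose rank is the dimension of the `d`-th power of the span of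
the coordinates of `ξ`. If the coordinates are linearly independent, this dimension is at least
`N d + 1` (`le_finrank_pow`), and nothing more is needed.

In general `ξ` spans a proper linear subspace, given by a matrix `A`. The deformations are then
split into three parts. Those that move the subspace are counted by the entries of `A`. Those of
the restriction `f₀` of `f` to the subspace are bounded by the evaluation at `ξ` as before, but
over the algebraic closure `E` of the field of coefficients of `f₀`
(`finrank_range_derivativeMap_add_le`). For those that preserve both, differentiating the vanishing
of the partial derivatives of `f` at `ξ` shows that the gradient of `D f` transversal to the
subspace is confined to a space of dimension less than the number of independent derivations of
`E(ξ)` over `E` (`exists_submodule_transversalGradient_mem`,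
`finrank_transversalGradient_mem_add_le`). If this number is large, the third part is large, but
then the second part is small: over `E`, the point `ξ` is the generic point of a variety of higher
dimension, and the dimension of the `d`-th power of the span of its coordinates grows accordingly
(`le_finrank_pow_of_dual_derivations`). The latter bound is proved by cutting with generic
hyperplanes (`exists_slice`).
-/

universe u

/-! ### Extension of derivations -/

/-- A derivation of `K` extends to the polynomial ring with prescribed values at the variables. The
extension is encoded as a ring homomorphism to the dual numbers over `L`, whose first component is
the evaluation at `v`. -/
theorem exists_derivation_mvPolynomial {E K L ι : Type*} [Field E] [Field K] [Field L]
    [Algebra E K] [Algebra K L] [Algebra E L] [IsScalarTower E K L]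
    (D₀ : Derivation E K L) (v a : ι → L) :
    ∃ f : MvPolynomial ι K →+* TrivSqZeroExt L L,
      (∀ p, (f p).fst = aeval v p) ∧ (∀ x, (f (C x)).snd = D₀ x) ∧ ∀ i, (f (X i)).snd = a i := by
  let g : K →+* TrivSqZeroExt L L :=
    { toFun := fun x => .inl (algebraMap K L x) + .inr (D₀ x)
      map_one' := by ext <;> simp
      map_zero' := by ext <;> simp
      map_add' := fun x y => by ext <;> simp
      map_mul' := fun x y => by
        ext
        · simp
        · rw [D₀.leibniz, Algebra.smul_def, Algebra.smul_def]
          simp only [TrivSqZeroExt.snd_mul, TrivSqZeroExt.snd_add, TrivSqZeroExt.snd_inl,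
            TrivSqZeroExt.snd_inr, TrivSqZeroExt.fst_add, TrivSqZeroExt.fst_inl,
            TrivSqZeroExt.fst_inr, smul_eq_mul,
            MulOpposite.smul_eq_mul_unop, MulOpposite.unop_op]
          ring }
  have hg (x : K) : g x = .inl (algebraMap K L x) + .inr (D₀ x) := rfl
  let f := eval₂Hom g fun i => (.inl (v i) + .inr (a i) : TrivSqZeroExt L L)
  have hfX (i : ι) : f (X i) = .inl (v i) + .inr (a i) := eval₂Hom_X' _ _ _
  have hfC (x : K) : f (C x) = g x := eval₂Hom_C _ _ _
  refine ⟨f, fun p => ?_, fun x => ?_, fun i => ?_⟩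
  · induction p using MvPolynomial.induction_on with
    | C x => simp [hfC, hg]
    | add p q hp hq => simp [hp, hq]
    | mul_X p i hp => rw [map_mul, TrivSqZeroExt.fst_mul, hp, hfX]; simp
  · simp [hfC, hg]
  · simp [hfX]

open scoped IntermediateField.algebraAdjoinAdjoin in
theorem formallyEtale_adjoin {K L ι : Type*} [Field K] [Field L] [CharZero K] [Algebra K L]
    {v : ι → L} (hv : IsTranscendenceBasis K v) :
    Algebra.FormallyEtale (Algebra.adjoin K (Set.range v)) L := by
  have h1 : Algebra.FormallyEtale (Algebra.adjoin K (Set.range v))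
      (IntermediateField.adjoin K (Set.range v)) := .of_isLocalization (nonZeroDivisors _)
  have := hv.isAlgebraic_field
  have : Algebra.FormallyEtale (IntermediateField.adjoin K (Set.range v)) L :=
    Algebra.FormallyEtale.of_isSeparable _ L
  exact .comp _ (IntermediateField.adjoin K (Set.range v)) _

/-- In characteristic zero a derivation of `K` extends to `L`, with arbitrary values on
algebraically independent elements: the values on a transcendence basis are free, and `L` is
formally étale over the polynomial ring in this basis. -/
theorem exists_derivation_extension {E K L ι : Type*} [Field E] [Field K] [Field L] [CharZero K]
    [Algebra E K] [Algebra K L] [Algebra E L] [IsScalarTower E K L]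
    (D₀ : Derivation E K L) {s : ι → L} (hs : AlgebraicIndependent K s) (a : ι → L) :
    ∃ D : Derivation E L L, (∀ x, D (algebraMap K L x) = D₀ x) ∧ ∀ i, D (s i) = a i := by
  obtain ⟨B, hsB, hB⟩ := exists_isTranscendenceBasis_superset hs.to_subtype_range
  obtain ⟨a', ha'⟩ : ∃ a' : B → L, ∀ i, a' ⟨s i, hsB ⟨i, rfl⟩⟩ = a i := by
    refine ⟨fun b => Function.extend s a 0 b, fun i => ?_⟩
    exact hs.injective.extend_apply _ _ _
  obtain ⟨f, hf1, hf2, hf3⟩ := exists_derivation_mvPolynomial D₀ (fun b : B => (b : L)) a'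
  let R := Algebra.adjoin K (Set.range fun b : B => (b : L))
  have hR : Algebra.FormallyEtale R L := formallyEtale_adjoin hB
  let e : MvPolynomial B K ≃ₐ[K] R := hB.1.aevalEquiv
  have he (r : R) : aeval (fun b : B => (b : L)) (e.symm r) = (r : L) := by
    rw [← hB.1.algebraMap_aevalEquiv]
    change ((e (e.symm r) : R) : L) = _
    rw [e.apply_symm_apply]
  have : IsScalarTower E R L := inferInstance
  have heE (c : E) : e.symm (algebraMap E R c) = C (algebraMap E K c) := by
    rw [AlgEquiv.symm_apply_eq, ← MvPolynomial.algebraMap_eq, AlgEquiv.commutes,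
      ← IsScalarTower.algebraMap_apply E K R]
  let D₁ : Derivation E R L := Derivation.mk'
    { toFun := fun r => (f (e.symm r)).snd
      map_add' := fun x y => by simp
      map_smul' := fun c x => by
        rw [Algebra.smul_def, map_mul, heE, map_mul, TrivSqZeroExt.snd_mul, hf1, hf2, hf1]
        simp [Algebra.smul_def, IsScalarTower.algebraMap_apply E K L] }
    (fun x y => by
      change (f (e.symm (x * y))).snd = x • (f (e.symm y)).snd + y • (f (e.symm x)).snd
      rw [map_mul, map_mul, TrivSqZeroExt.snd_mul, hf1, hf1, he, he, op_smul_eq_smul]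
      rfl)
  let D : Derivation E L L := ((D₁.liftKaehlerDifferential.liftBaseChange L) ∘ₗ
    (KaehlerDifferential.tensorKaehlerEquivOfFormallyEtale E R L).symm.toLinearMap).compDer
      (KaehlerDifferential.D E L)
  have hD (r : R) : D (r : L) = (f (e.symm r)).snd := by
    have := KaehlerDifferential.tensorKaehlerEquivOfFormallyEtale_symm_D_algebraMap E R L r
    change (D₁.liftKaehlerDifferential.liftBaseChange L)
      ((KaehlerDifferential.tensorKaehlerEquivOfFormallyEtale E R L).symm
        (KaehlerDifferential.D E L (algebraMap R L r))) = _
    rw [this]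
    simp [D₁]
  refine ⟨D, fun x => ?_, fun i => ?_⟩
  · have h1 := hD (algebraMap K R x)
    rw [e.symm.commutes, MvPolynomial.algebraMap_eq, hf2] at h1
    exact h1
  · have h1 := hD (e (X ⟨s i, hsB ⟨i, rfl⟩⟩))
    rw [e.symm_apply_apply, hf3, ha'] at h1
    rw [← h1]
    congr 1
    have := hB.1.algebraMap_aevalEquiv (X ⟨s i, hsB ⟨i, rfl⟩⟩)
    rw [aeval_X] at this
    exact this.symm

/-- A derivation that vanishes on a subfield vanishes on everything algebraic over it. -/
theorem derivation_eq_zero_of_isAlgebraic {k K L M : Type*} [Field k] [Field K] [Field L]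
    [CharZero L] [Algebra k L] [Algebra K L] [AddCommGroup M] [Module L M] [Module k M]
    (D : Derivation k L M)
    (hK : ∀ x, D (algebraMap K L x) = 0) {x : L} (hx : IsAlgebraic K x) :
    D x = 0 := by
  let _ : Module K M := Module.compHom M (algebraMap K L)
  have : IsScalarTower K L M := ⟨fun c y m => by
    rw [Algebra.smul_def, mul_smul]
    rfl⟩
  let D' : Derivation K L M := Derivation.mk'
    { toFun := D
      map_add' := map_add D
      map_smul' := fun c y => by
        change D (c • y) = c • D y
        rw [Algebra.smul_def, D.leibniz, hK, smul_zero, add_zero, algebraMap_smul] }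
    fun y z => D.leibniz y z
  have h1 : D' x = D x := rfl
  have : CharZero K := (algebraMap K L).charZero_iff (algebraMap K L).injective |>.2 ‹_›
  have h2 := D'.map_aeval (minpoly K x) x
  rw [minpoly.aeval, D'.map_zero] at h2
  rw [← h1]
  have hne : Polynomial.aeval x (Polynomial.derivative (minpoly K x)) ≠ 0 :=
    (minpoly.irreducible hx.isIntegral).separable.aeval_derivative_ne_zero (minpoly.aeval K x)
  exact (smul_eq_zero.1 h2.symm).resolve_left hne

/-! ### Powers of subspaces of field extensions -/

/-- A finitely generated algebra over an algebraically closed field has a rational point. -/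
theorem nonempty_algHom_adjoin {E F : Type*} [Field E] [Field F] [Algebra E F] [IsAlgClosed E]
    {S : Set F} (hS : S.Finite) : Nonempty (Algebra.adjoin E S →ₐ[E] E) := by
  let R := Algebra.adjoin E S
  have hfg : Algebra.FiniteType E R := by
    rw [← Subalgebra.fg_iff_finiteType]
    exact ⟨hS.toFinset, by simp [R]⟩
  obtain ⟨m, hm⟩ := Ideal.exists_maximal R
  let _ : Field (R ⧸ m) := Ideal.Quotient.field m
  have : Module.Finite E (R ⧸ m) := finite_of_finite_type_of_isJacobsonRing E (R ⧸ m)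
  have hb := IsAlgClosed.algebraMap_bijective_of_isIntegral (k := E) (K := R ⧸ m)
  let e : E ≃ₐ[E] (R ⧸ m) := AlgEquiv.ofBijective (Algebra.ofId E (R ⧸ m)) hb
  exact ⟨e.symm.toAlgHom.comp (Ideal.Quotient.mkₐ E m)⟩

theorem finiteDimensional_mul {E F : Type*} [Field E] [Field F] [Algebra E F]
    (A B : Submodule E F) [FiniteDimensional E A] [FiniteDimensional E B] :
    FiniteDimensional E (A * B : Submodule E F) :=
  (Submodule.fg_iff_finiteDimensional _).1
    (((Submodule.fg_iff_finiteDimensional A).2 ‹_›).mul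
      ((Submodule.fg_iff_finiteDimensional B).2 ‹_›))

theorem finiteDimensional_pow {E F : Type*} [Field E] [Field F] [Algebra E F]
    (V : Submodule E F) [FiniteDimensional E V] (e : ℕ) :
    FiniteDimensional E (V ^ e : Submodule E F) :=
  (Submodule.fg_iff_finiteDimensional _).1
    (((Submodule.fg_iff_finiteDimensional V).2 ‹_›).pow e)

theorem finrank_le_finrank_mul {E F : Type*} [Field E] [Field F] [Algebra E F]
    (A B : Submodule E F) [FiniteDimensional E A] [FiniteDimensional E B] (hA : A ≠ ⊥) :
    Module.finrank E B ≤ Module.finrank E (A * B : Submodule E F) := by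
  obtain ⟨a, ha, ha0⟩ := Submodule.exists_mem_ne_zero_of_ne_bot hA
  have hle : B.map (LinearMap.mulLeft E a) ≤ A * B := by
    rintro _ ⟨b, hb, rfl⟩
    exact Submodule.mul_mem_mul ha hb
  have hinj : Function.Injective (LinearMap.mulLeft E a) := fun x y h => mul_left_cancel₀ ha0 h
  have := finiteDimensional_mul A B
  rw [(Submodule.equivMapOfInjective _ hinj B).finrank_eq]
  exact Submodule.finrank_mono hle

/-- Over an algebraically closed field, a product of two finite-dimensional subspaces of an
extension field has at least the dimension of a product of two polynomial spaces in one variable.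
For the induction, a point of the algebra generated by `A` and `B` cuts out a hyperplane `A₁` of
`A`, and `A₁ * B` misses a product that is nonzero at this point. -/
theorem finrank_add_finrank_le {E F : Type*} [Field E] [Field F] [Algebra E F] [IsAlgClosed E]
    (A B : Submodule E F) [FiniteDimensional E A] [FiniteDimensional E B] (hA : A ≠ ⊥)
    (hB : B ≠ ⊥) :
    Module.finrank E A + Module.finrank E B ≤ Module.finrank E (A * B : Submodule E F) + 1 := by
  induction hn : Module.finrank E A using Nat.strong_induction_on generalizing A with
  | _ n ih =>
  obtain hn1 | hn1 := le_or_gt n 1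
  · have := finrank_le_finrank_mul A B hA
    omega
  obtain ⟨a, haA, ha0⟩ := Submodule.exists_mem_ne_zero_of_ne_bot hA
  obtain ⟨b, hbB, hb0⟩ := Submodule.exists_mem_ne_zero_of_ne_bot hB
  obtain ⟨sA, hsA⟩ := (Submodule.fg_iff_finiteDimensional A).2 ‹_›
  obtain ⟨sB, hsB⟩ := (Submodule.fg_iff_finiteDimensional B).2 ‹_›
  let S : Set F := sA ∪ sB ∪ {a⁻¹, b⁻¹}
  have hS : S.Finite := by simp [S]
  obtain ⟨φ⟩ := nonempty_algHom_adjoin (E := E) hS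
  let R := Algebra.adjoin E S
  have hAR : A ≤ Subalgebra.toSubmodule R := by
    rw [← hsA, Submodule.span_le]
    exact fun x hx => Algebra.subset_adjoin (Or.inl (Or.inl hx))
  have hBR : B ≤ Subalgebra.toSubmodule R := by
    rw [← hsB, Submodule.span_le]
    exact fun x hx => Algebra.subset_adjoin (Or.inl (Or.inr hx))
  have key (x : F) (hx : x ∈ R) (hx0 : x ≠ 0) (hxi : x⁻¹ ∈ R) : φ ⟨x, hx⟩ ≠ 0 := by
    intro h
    have : φ (⟨x, hx⟩ * ⟨x⁻¹, hxi⟩) = 1 := by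
      rw [← map_one φ]
      congr 1
      exact Subtype.ext (mul_inv_cancel₀ hx0)
    rw [map_mul, h, zero_mul] at this
    exact zero_ne_one this
  have hφa : φ ⟨a, hAR haA⟩ ≠ 0 := key a _ ha0 (Algebra.subset_adjoin (by simp [S]))
  have hφb : φ ⟨b, hBR hbB⟩ ≠ 0 := key b _ hb0 (Algebra.subset_adjoin (by simp [S]))
  let l : A →ₗ[E] E := φ.toLinearMap ∘ₗ Submodule.inclusion hAR
  have hl : l ≠ 0 := fun h => hφa (LinearMap.congr_fun h ⟨a, haA⟩)
  let A₁ := (LinearMap.ker l).map A.subtype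
  have hA₁ : Module.finrank E A₁ + 1 = n := by
    rw [← hn, ← (Submodule.equivMapOfInjective _ A.injective_subtype _).finrank_eq]
    exact Module.Dual.finrank_ker_add_one_of_ne_zero hl
  have hA₁' : A₁ ≠ ⊥ := by
    intro h
    rw [h, finrank_bot] at hA₁
    omega
  have hA₁A : A₁ ≤ A := Submodule.map_subtype_le _ _
  have : FiniteDimensional E A₁ := Submodule.finiteDimensional_of_le hA₁A
  have ih1 := ih _ (by omega) A₁ hA₁' rfl
  have hlt : A₁ * B < A * B := by
    refine lt_of_le_of_ne (mul_le_mul_left hA₁A B) fun h => ?_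
    have hmem : a * b ∈ A₁ * B := h ▸ Submodule.mul_mem_mul haA hbB
    have hle : A₁ * B ≤ (LinearMap.ker φ.toLinearMap).map R.val.toLinearMap := by
      rw [Submodule.mul_le]
      rintro _ ⟨x, hx, rfl⟩ y hy
      refine ⟨⟨x, hAR x.2⟩ * ⟨y, hBR hy⟩, ?_, rfl⟩
      have hx' : φ ⟨x, hAR x.2⟩ = 0 := hx
      simp [hx']
    obtain ⟨z, hz, hz'⟩ := hle hmem
    have : z = ⟨a, hAR haA⟩ * ⟨b, hBR hbB⟩ := Subtype.ext hz'
    rw [this] at hz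
    have hz2 : φ (⟨a, hAR haA⟩ * ⟨b, hBR hbB⟩) = 0 := hz
    rw [map_mul] at hz2
    exact (mul_ne_zero hφa hφb) hz2
  have := finiteDimensional_mul A B
  have := Submodule.finrank_lt_finrank_of_lt hlt
  omega

/-- The powers of a space of dimension `k + 1` grow at least as fast as for the space of
homogeneous coordinates of a rational normal curve of degree `k`. -/
theorem le_finrank_pow {E F : Type*} [Field E] [Field F] [Algebra E F] [IsAlgClosed E]
    (V : Submodule E F) [FiniteDimensional E V] {k : ℕ} (hV : Module.finrank E V = k + 1) (e : ℕ) :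
    k * e + 1 ≤ Module.finrank E (V ^ e : Submodule E F) := by
  have hV0 : V ≠ ⊥ := by
    rintro rfl
    simp at hV
  have hfin (e : ℕ) := finiteDimensional_pow V e
  induction e with
  | zero =>
    rw [pow_zero]
    have : (1 : Submodule E F) = E ∙ (1 : F) := Submodule.one_eq_span
    rw [this, finrank_span_singleton one_ne_zero]
    simp
  | succ e ih =>
    have h0 : V ^ e ≠ ⊥ := by
      intro h
      rw [h, finrank_bot] at ih
      omega
    have := finrank_add_finrank_le (V ^ e) V h0 hV0
    rw [pow_succ, mul_add, mul_one]
    omega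

/-! ### Derivations and generators of a field -/

theorem derivation_eq_zero_of_mem_adjoin {E L M : Type*} [Field E] [Field L] [Algebra E L]
    [AddCommGroup M] [Module L M] [Module E M] (D : Derivation E L M) {S : Set L}
    (h : ∀ s ∈ S, D s = 0) {x : L} (hx : x ∈ IntermediateField.adjoin E S) : D x = 0 := by
  induction hx using IntermediateField.adjoin_induction with
  | mem s hs => exact h s hs
  | algebraMap c => exact D.map_algebraMap c
  | add x y _ _ hx hy => rw [map_add, hx, hy, add_zero]
  | inv x _ hx => rw [D.leibniz_inv, hx, smul_zero]
  | mul x y _ _ hx hy => rw [D.leibniz, hx, hy, smul_zero, smul_zero, add_zero]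

theorem derivation_eq_zero_of_span {E K M : Type*} [Field E] [Field K] [Algebra E K]
    [AddCommGroup M] [Module K M] [Module E M] [IsScalarTower E K M] {S : Set K}
    (hS : Submodule.span K (KaehlerDifferential.D E K '' S) = ⊤)
    (D : Derivation E K M) (h : ∀ s ∈ S, D s = 0) (x : K) : D x = 0 := by
  have h1 : D.liftKaehlerDifferential = 0 := by
    refine LinearMap.ext_on hS ?_
    rintro _ ⟨s, hs, rfl⟩
    simp [h s hs]
  rw [← D.liftKaehlerDifferential_comp_D x, h1, LinearMap.zero_apply]

/-- The differentials of generators span the differentials of a field algebraic over the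
field generated. -/
theorem span_D_algebraicClosure {E L : Type*} [Field E] [Field L] [CharZero L] [Algebra E L]
    (S : Set L) :
    Submodule.span (algebraicClosure (IntermediateField.adjoin E S) L)
      (KaehlerDifferential.D E (algebraicClosure (IntermediateField.adjoin E S) L) ''
        ((↑) ⁻¹' S)) = ⊤ := by
  set K := IntermediateField.adjoin E S
  set E' := algebraicClosure K L
  set N := Submodule.span E' (KaehlerDifferential.D E E' '' ((↑) ⁻¹' S))
  let D : Derivation E E' (Ω[E'⁄E] ⧸ N) := N.mkQ.compDer (KaehlerDifferential.D E E')
  have hD (x : E') : D x = 0 := by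
    refine derivation_eq_zero_of_isAlgebraic (K := K) D (fun z => ?_)
      (Algebra.IsAlgebraic.isAlgebraic x)
    obtain ⟨z, hz⟩ := z
    have key (z : L) (hz : z ∈ K) : ∀ hz' : z ∈ E', D ⟨z, hz'⟩ = 0 := by
      have hKE (z : L) (hz : z ∈ K) : z ∈ E' := E'.algebraMap_mem ⟨z, hz⟩
      induction hz using IntermediateField.adjoin_induction with
      | mem s hs =>
        intro hz'
        exact (Submodule.Quotient.mk_eq_zero _).2 (Submodule.subset_span ⟨_, hs, rfl⟩)
      | algebraMap c => exact fun _ => D.map_algebraMap c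
      | add x y hx' hy' hx hy =>
        intro hz'
        have := D.map_add ⟨x, hKE x hx'⟩ ⟨y, hKE y hy'⟩
        rw [hx, hy, add_zero] at this
        exact this
      | inv x hx' hx =>
        intro hz'
        have := D.leibniz_inv ⟨x, hKE x hx'⟩
        rw [hx, smul_zero] at this
        exact this
      | mul x y hx' hy' hx hy =>
        intro hz'
        have := D.leibniz ⟨x, hKE x hx'⟩ ⟨y, hKE y hy'⟩
        rw [hx, hy, smul_zero, smul_zero, add_zero] at this
        exact this
    exact key z hz _
  rw [eq_top_iff, ← KaehlerDifferential.span_range_derivation, Submodule.span_le]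
  rintro _ ⟨x, rfl⟩
  exact (Submodule.Quotient.mk_eq_zero _).1 (hD x)

/-- A derivation preserves a subfield once it maps generators into it. -/
theorem derivation_mem_range {E K L : Type*} [Field E] [Field K] [Field L] [Algebra E K]
    [Algebra K L] [Algebra E L] [IsScalarTower E K L] {S : Set K}
    (hS : Submodule.span K (KaehlerDifferential.D E K '' S) = ⊤)
    (D : Derivation E L L) (h : ∀ s ∈ S, ∃ z, algebraMap K L z = D (algebraMap K L s)) (x : K) :
    ∃ z, algebraMap K L z = D (algebraMap K L x) := by
  let N := LinearMap.range (Algebra.linearMap K L)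
  let D' : Derivation E K (L ⧸ N) := N.mkQ.compDer (D.compAlgebraMap K)
  have := derivation_eq_zero_of_span hS D' (fun s hs => by
    exact (Submodule.Quotient.mk_eq_zero _).2 (h s hs)) x
  exact (Submodule.Quotient.mk_eq_zero _).1 this

theorem exists_derivation_of_vanishing {E K L : Type*} [Field E] [Field K] [Field L] [Algebra E L]
    [Algebra K L] (D : Derivation E L L) (h : ∀ x, D (algebraMap K L x) = 0) :
    ∃ D' : Derivation K L L, ∀ x, D' x = D x :=
  ⟨Derivation.mk'
    { toFun := D
      map_add' := map_add D
      map_smul' := fun c y => by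
        change D (c • y) = c • D y
        rw [Algebra.smul_def, D.leibniz, h, smul_zero, add_zero, smul_eq_mul, Algebra.smul_def] }
    fun y z => D.leibniz y z, fun _ => rfl⟩

/-! ### Generic hyperplane sections -/

theorem derivation_sum_apply {E L M ι : Type*} [CommRing E] [CommRing L] [Algebra E L]
    [AddCommGroup M] [Module L M] [Module E M] (s : Finset ι) (D : ι → Derivation E L M) (x : L) :
    (∑ i ∈ s, D i) x = ∑ i ∈ s, D i x := by
  have := map_sum (Derivation.coeFnAddMonoidHom (R := E) (A := L) (M := M)) D s
  exact (congrFun this x).trans (Finset.sum_apply _ _ _)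

theorem exists_algebraMap_eq_of_isIntegral {K L : Type*} [Field K] [Field L] [Algebra K L]
    [IsAlgClosed K] {z : L} (hz : IsIntegral K z) : ∃ x, algebraMap K L x = z :=
  minpoly.mem_range_of_degree_eq_one K z
    (IsAlgClosed.degree_eq_one_of_irreducible K (minpoly.irreducible hz))

theorem exists_derivation_eq_one {E L : Type*} [Field E] [Field L] [CharZero E] [Algebra E L]
    {x : L} (hx : Transcendental E x) : ∃ D : Derivation E L L, D x = 1 := by
  obtain ⟨D, -, h⟩ := exists_derivation_extension (0 : Derivation E E L)
    ((algebraicIndependent_unique_type_iff (ι := Unit) (x := fun _ => x)).2 hx) (fun _ => 1)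
  exact ⟨D, h ()⟩

/-- A generic hyperplane section loses at most one dimension. The field `K` is algebraic over the
one generated over `E` by coefficients `t i` and by `y = ∑ i, t i * ξ i`; the elements `ξ i` of `L`
are independent over `E` and contain `1` in their span. Over `K` there is the relation
`∑ i, (t i - y * e i) * ξ i = 0`, and up to multiples it is the only one. Indeed, let
`θ c = ∑ i, c i * D₀ (ξ i)` for a relation `c`. Then `θ c` lies in `K`, because multiplication by it
preserves the span of the `ξ i`. The relations with `θ c = 0` are stable under derivations of `K`
whose common field of constants is `E`; if they were not all zero, a nonzero one of minimal
support could be scaled to have coefficients in `E`, against the independence of the `ξ i`. -/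
theorem card_le_finrank_span_add_one {E K L ι : Type*} [Field E] [Field K] [Field L] [CharZero E]
    [CharZero L] [Algebra E K] [Algebra K L] [Algebra E L] [IsScalarTower E K L] [IsAlgClosed E]
    [IsAlgClosed K] [Fintype ι] [DecidableEq ι] (t : ι → K) (y : K)
    (hS : Submodule.span K (KaehlerDifferential.D E K '' insert y (Set.range t)) = ⊤)
    (ξ : ι → L) (hξ : LinearIndependent E ξ) (hy : algebraMap K L y = ∑ i, t i • ξ i)
    (e : ι → E) (he : ∑ i, e i • ξ i = 1)
    (D₀ : Derivation E L L) (hD₀t : ∀ i, D₀ (algebraMap K L (t i)) = 0)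
    (hD₀y : D₀ (algebraMap K L y) = 1)
    (P : ι → Derivation E L L) (hPξ : ∀ i j, P i (ξ j) = 0)
    (hPt : ∀ i j, P i (algebraMap K L (t j)) = if i = j then 1 else 0)
    (hne : ∃ j, ξ j ∉ Set.range (algebraMap K L)) :
    Fintype.card ι ≤ Module.finrank K (Submodule.span K (Set.range ξ)) + 1 := by
  classical
  obtain ⟨j₀, hj₀⟩ := hne
  have hinj : Function.Injective (algebraMap K L) := (algebraMap K L).injective
  -- the derivations `P j - ξ j • D₀` kill `y`
  let D (j : ι) : Derivation E L L := P j - ξ j • D₀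
  have hDt (i j : ι) : D i (algebraMap K L (t j)) = if i = j then 1 else 0 := by
    simp [D, hPt, hD₀t]
  have hDξ (i j : ι) : D i (ξ j) = -(ξ i * D₀ (ξ j)) := by simp [D, hPξ]
  have hDy (i : ι) : D i (algebraMap K L y) = 0 := by
    have : P i (algebraMap K L y) = ξ i := by
      rw [hy, map_sum]
      simp [Algebra.smul_def, hPξ, hPt]
    simp [D, this, hD₀y]
  have hex₀ (x : K) : ∃ z, algebraMap K L z = D₀ (algebraMap K L x) := by
    refine derivation_mem_range hS D₀ ?_ x
    rintro s (hs | ⟨i, rfl⟩)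
    · rw [hs]
      exact ⟨1, by rw [hD₀y, map_one]⟩
    · exact ⟨0, by rw [hD₀t, map_zero]⟩
  have hex (j : ι) (x : K) : ∃ z, algebraMap K L z = D j (algebraMap K L x) := by
    refine derivation_mem_range hS (D j) ?_ x
    rintro s (hs | ⟨i, rfl⟩)
    · rw [hs]
      exact ⟨0, by rw [hDy, map_zero]⟩
    · exact ⟨if j = i then 1 else 0, by rw [hDt]; split_ifs <;> simp⟩
  choose d₀ hd₀ using hex₀
  choose d hd using hex
  have hcomm (j : ι) (x : K) : d₀ (d j x) = d j (d₀ x) := by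
    apply hinj
    rw [hd₀, hd, hd, hd₀]
    have := derivation_eq_zero_of_span hS (⁅D₀, D j⁆.compAlgebraMap K) (by
      rintro s (hs | ⟨i, rfl⟩)
      · rw [hs]
        change ⁅D₀, D j⁆ (algebraMap K L y) = 0
        rw [Derivation.commutator_apply, hDy, hD₀y]
        simp
      · change ⁅D₀, D j⁆ (algebraMap K L (t i)) = 0
        rw [Derivation.commutator_apply, hDt, hD₀t]
        split_ifs <;> simp) x
    change ⁅D₀, D j⁆ (algebraMap K L x) = 0 at this
    rw [Derivation.commutator_apply, sub_eq_zero] at this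
    exact this
  -- constants of all these derivations
  have hconst (x : K) (h0 : d₀ x = 0) (h : ∀ j, d j x = 0) : ∃ c : E, algebraMap E K c = x := by
    by_contra hx
    have htr : Transcendental E (algebraMap K L x) := by
      rw [transcendental_algebraMap_iff hinj]
      intro halg
      exact hx (exists_algebraMap_eq_of_isIntegral halg.isIntegral)
    obtain ⟨Δ, hΔ⟩ := exists_derivation_eq_one htr
    let Δ' : Derivation E L L := Δ - Δ (algebraMap K L y) • D₀ -
      ∑ i, Δ (algebraMap K L (t i)) • D i
    have hΔ'a (z : L) : Δ' z = Δ z - Δ (algebraMap K L y) * D₀ z -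
        ∑ i, Δ (algebraMap K L (t i)) * D i z := by
      simp [Δ', derivation_sum_apply]
    have := derivation_eq_zero_of_span hS (Δ'.compAlgebraMap K) (by
      rintro s (hs | ⟨i, rfl⟩)
      · rw [hs]
        change Δ' (algebraMap K L y) = 0
        rw [hΔ'a]
        simp [hD₀y, hDy]
      · change Δ' (algebraMap K L (t i)) = 0
        rw [hΔ'a]
        simp [hD₀t, hDt]) x
    change Δ' (algebraMap K L x) = 0 at this
    rw [hΔ'a, hΔ] at this
    simp [← hd₀, ← hd, h0, h] at this
  let θ (c : ι → K) : L := ∑ i, c i • D₀ (ξ i)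
  -- relations between the `ξ i` and their derivatives
  have hrel₀ (c : ι → K) (hc : ∑ i, c i • ξ i = 0) : ∑ i, d₀ (c i) • ξ i = -θ c := by
    have := congrArg D₀ hc
    rw [map_sum, map_zero] at this
    simp only [Algebra.smul_def, Derivation.leibniz, ← hd₀, Algebra.algebraMap_self_apply,
      Finset.sum_add_distrib] at this
    simp only [θ, Algebra.smul_def]
    rw [eq_neg_iff_add_eq_zero, add_comm, ← this]
    congr 1
    exact Finset.sum_congr rfl fun i _ => mul_comm _ _
  have hrel (j : ι) (c : ι → K) (hc : ∑ i, c i • ξ i = 0) :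
      ∑ i, d j (c i) • ξ i = ξ j * θ c := by
    have := congrArg (D j) hc
    rw [map_sum, map_zero] at this
    simp only [Algebra.smul_def, Derivation.leibniz, ← hd, Algebra.algebraMap_self_apply, hDξ,
      Finset.sum_add_distrib] at this
    simp only [θ, Algebra.smul_def, Finset.mul_sum]
    rw [← sub_eq_zero, ← this, sub_eq_add_neg, add_comm, ← Finset.sum_neg_distrib]
    congr 1
    · exact Finset.sum_congr rfl fun i _ => by ring
    · exact Finset.sum_congr rfl fun i _ => mul_comm _ _
  have hθ (c : ι → K) (hc : ∑ i, c i • ξ i = 0) : ∃ x, algebraMap K L x = θ c := by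
    refine exists_algebraMap_eq_of_isIntegral (isIntegral_of_smul_mem_submodule
      (Submodule.span K (Set.range ξ)) ?_ (Submodule.fg_span (Set.finite_range ξ)) (θ c) ?_)
    · rw [Submodule.ne_bot_iff]
      exact ⟨ξ j₀, Submodule.subset_span ⟨_, rfl⟩, fun h => hj₀ ⟨0, by rw [h, map_zero]⟩⟩
    · intro n hn
      induction hn using Submodule.span_induction with
      | mem z hz =>
        obtain ⟨j, rfl⟩ := hz
        rw [smul_eq_mul, mul_comm, ← hrel j c hc]
        exact Submodule.sum_mem _ fun i _ =>
          Submodule.smul_mem _ _ (Submodule.subset_span ⟨i, rfl⟩)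
      | zero => simp
      | add x y _ _ hx hy => rw [smul_add]; exact add_mem hx hy
      | smul a x _ hx => rw [smul_comm]; exact Submodule.smul_mem _ _ hx
  have hstab₀ (c : ι → K) (hc : ∑ i, c i • ξ i = 0) (hc' : θ c = 0) :
      ∑ i, d₀ (c i) • ξ i = 0 ∧ θ (fun i => d₀ (c i)) = 0 := by
    have h1 : ∑ i, d₀ (c i) • ξ i = 0 := by rw [hrel₀ c hc, hc', neg_zero]
    have h2 : ∑ i, d j₀ (c i) • ξ i = 0 := by rw [hrel _ c hc, hc', mul_zero]
    refine ⟨h1, ?_⟩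
    have h3 := hrel j₀ _ h1
    have h4 := hrel₀ _ h2
    simp only [hcomm] at h4
    rw [h3] at h4
    obtain ⟨u, hu⟩ := hθ _ h1
    obtain ⟨v, hv⟩ := hθ _ h2
    by_contra h0
    refine hj₀ ⟨-v / u, ?_⟩
    rw [map_div₀, map_neg, hu, hv, ← h4, mul_div_cancel_right₀ _ h0]
  have hstab (j : ι) (c : ι → K) (hc : ∑ i, c i • ξ i = 0) (hc' : θ c = 0) :
      ∑ i, d j (c i) • ξ i = 0 ∧ θ (fun i => d j (c i)) = 0 := by
    have h1 := hstab₀ c hc hc'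
    have h2 : ∑ i, d j (c i) • ξ i = 0 := by rw [hrel _ c hc, hc', mul_zero]
    refine ⟨h2, ?_⟩
    have h3 := hrel j _ h1.1
    have h4 := hrel₀ _ h2
    simp only [hcomm] at h4
    rw [h3, h1.2, mul_zero] at h4
    exact neg_eq_zero.1 h4.symm
  have hd1 : ∀ x, x = 1 → d₀ x = 0 ∧ ∀ j, d j x = 0 := by
    rintro _ rfl
    exact ⟨hinj (by rw [hd₀]; simp), fun j => hinj (by rw [hd]; simp)⟩
  have hd0 : ∀ x, x = 0 → d₀ x = 0 ∧ ∀ j, d j x = 0 := by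
    rintro _ rfl
    exact ⟨hinj (by rw [hd₀]; simp), fun j => hinj (by rw [hd]; simp)⟩
  -- a relation of minimal support with an entry `1` has constant entries
  have hzero (n : ℕ) : ∀ c : ι → K, ∑ i, c i • ξ i = 0 → θ c = 0 →
      (Finset.univ.filter fun i => c i ≠ 0).card ≤ n → c = 0 := by
    induction n with
    | zero =>
      intro c _ _ hcard
      ext i
      by_contra hi
      have : i ∈ Finset.univ.filter fun i => c i ≠ 0 := by simpa using hi
      rw [Finset.card_eq_zero.1 (Nat.le_zero.1 hcard)] at this
      simp at this
    | succ n ih =>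
      intro c hc hc' hcard
      by_contra hne
      obtain ⟨i₀, hi₀⟩ := Function.ne_iff.1 hne
      have hi₀' : c i₀ ≠ 0 := hi₀
      let b : ι → K := fun i => (c i₀)⁻¹ * c i
      have hb : ∑ i, b i • ξ i = 0 := by
        simp only [b, mul_smul, ← Finset.smul_sum, hc, smul_zero]
      have hb' : θ b = 0 := by
        simp only [θ, b, mul_smul, ← Finset.smul_sum]
        exact (congrArg _ hc').trans (smul_zero _)
      have hbi : b i₀ = 1 := inv_mul_cancel₀ hi₀'
      have hlt (g : K → K) (hg0 : ∀ x, x = 0 → g x = 0) (hg1 : g (b i₀) = 0) :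
          (Finset.univ.filter fun i => g (b i) ≠ 0).card ≤ n := by
        refine Nat.le_of_lt_succ (lt_of_lt_of_le (Finset.card_lt_card ?_) hcard)
        refine (Finset.ssubset_iff_of_subset fun i hi => ?_).2 ⟨i₀, by simpa using hi₀', by simpa⟩
        simp only [Finset.mem_filter, Finset.mem_univ, true_and] at hi ⊢
        intro h0
        exact hi (hg0 _ (by simp [b, h0]))
      have hb0 := ih (fun i => d₀ (b i)) (hstab₀ b hb hb').1 (hstab₀ b hb hb').2
        (hlt d₀ (fun x hx => (hd0 x hx).1) (hd1 _ hbi).1)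
      have hbj (j : ι) := ih (fun i => d j (b i)) (hstab j b hb hb').1 (hstab j b hb hb').2
        (hlt (d j) (fun x hx => (hd0 x hx).2 j) ((hd1 _ hbi).2 j))
      choose a ha using fun i => hconst (b i) (congrFun hb0 i) fun j => congrFun (hbj j) i
      have hsum : ∑ i, a i • ξ i = 0 := by
        rw [← hb]
        exact Finset.sum_congr rfl fun i _ => by rw [← ha, algebraMap_smul]
      have := Fintype.linearIndependent_iff.1 hξ a hsum i₀
      rw [← ha, this, map_zero] at hbi
      exact zero_ne_one hbi
  let Φ := Fintype.linearCombination K ξ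
  have hΦ (c : ι → K) : Φ c = ∑ i, c i • ξ i := Fintype.linearCombination_apply _ _ _
  have hker : Module.finrank K (LinearMap.ker Φ) ≤ 1 := by
    let c : ι → K := fun i => t i - y * algebraMap E K (e i)
    have he' : D₀ (∑ i, e i • ξ i) = 0 := by rw [he, D₀.map_one_eq_zero]
    have hcc : ∑ i, c i • ξ i = 0 := by
      simp only [c, sub_smul, Finset.sum_sub_distrib, ← hy, mul_smul, algebraMap_smul,
        ← Finset.smul_sum, he]
      rw [Algebra.smul_def, mul_one, sub_self]
    have hθc : θ c = 1 := by
      have h1 : D₀ (algebraMap K L y) = ∑ i, t i • D₀ (ξ i) := by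
        rw [hy, map_sum]
        simp [Algebra.smul_def, hD₀t]
      rw [map_sum] at he'
      simp only [Derivation.map_smul] at he'
      simp only [θ, c, sub_smul, Finset.sum_sub_distrib, ← h1, mul_smul, algebraMap_smul,
        ← Finset.smul_sum, he', smul_zero, sub_zero, hD₀y]
    refine finrank_le_one ⟨c, by rw [LinearMap.mem_ker, hΦ, hcc]⟩ ?_
    rintro ⟨b, hb⟩
    rw [LinearMap.mem_ker, hΦ] at hb
    obtain ⟨x, hx⟩ := hθ b hb
    refine ⟨x, Subtype.ext ?_⟩
    have hsub : ∑ i, (b i - x * c i) • ξ i = 0 := by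
      simp only [sub_smul, Finset.sum_sub_distrib, mul_smul, ← Finset.smul_sum, hcc, hb,
        smul_zero, sub_zero]
    have hsub' : θ (fun i => b i - x * c i) = 0 := by
      have : θ (fun i => b i - x * c i) = θ b - x • θ c := by
        simp only [θ, sub_smul, Finset.sum_sub_distrib, mul_smul, Finset.smul_sum]
      rw [this, hθc, ← hx, Algebra.smul_def, mul_one, sub_self]
    have := hzero _ _ hsub hsub' le_rfl
    ext i
    have := congrFun this i
    exact (sub_eq_zero.1 this).symm
  have hrange : LinearMap.range Φ = Submodule.span K (Set.range ξ) :=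
    Fintype.range_linearCombination _ _
  have := LinearMap.finrank_range_add_finrank_ker Φ
  rw [hrange, Module.finrank_fintype_fun_eq_card] at this
  omega

theorem span_pow_of_tower {E R L : Type*} [Field E] [Field R] [Field L] [Algebra E R] [Algebra R L]
    [Algebra E L] [IsScalarTower E R L] (V : Submodule E L) (n : ℕ) :
    Submodule.span R (V : Set L) ^ n = Submodule.span R ((V ^ n : Submodule E L) : Set L) := by
  rw [Submodule.span_pow]
  conv_rhs => rw [← Submodule.span_eq V, Submodule.span_pow, Submodule.span_span_of_tower]

theorem span_range_finBasis {K L : Type*} [Field K] [AddCommGroup L] [Module K L]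
    (V : Submodule K L) [FiniteDimensional K V] :
    Submodule.span K (Set.range fun i => (Module.finBasis K V i : L)) = V := by
  have := congrArg (Submodule.map V.subtype) (Module.finBasis K V).span_eq
  rw [Submodule.map_span, ← Set.range_comp, Submodule.map_top, Submodule.range_subtype] at this
  exact this

theorem finrank_span_le_finrank {E R L : Type*} [Field E] [Field R] [AddCommGroup L] [Algebra E R]
    [Module R L] [Module E L] [IsScalarTower E R L] (V : Submodule E L) [FiniteDimensional E V] :
    Module.finrank R (Submodule.span R (V : Set L)) ≤ Module.finrank E V := by
  have : Submodule.span R (V : Set L) =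
      Submodule.span R (Set.range fun i => (Module.finBasis E V i : L)) := by
    conv_lhs => rw [← span_range_finBasis V, Submodule.span_span_of_tower]
  rw [this]
  exact (finrank_range_le_card _).trans_eq (Fintype.card_fin _)

theorem finiteDimensional_span {E R L : Type*} [Field E] [Field R] [AddCommGroup L] [Algebra E R]
    [Module R L] [Module E L] [IsScalarTower E R L] (V : Submodule E L) [FiniteDimensional E V] :
    FiniteDimensional R (Submodule.span R (V : Set L)) := by
  obtain ⟨s, hs⟩ := (Submodule.fg_iff_finiteDimensional V).2 ‹_›
  rw [← Submodule.fg_iff_finiteDimensional, ← hs, Submodule.span_span_of_tower]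
  exact Submodule.fg_span s.finite_toSet

/-- Bases of the spans of an increasing sequence of sets can be chosen increasing. -/
theorem exists_nested_linearIndepOn {K L : Type*} [Field K] [AddCommGroup L] [Module K L]
    (W : ℕ → Set L) (hW : Monotone W) :
    ∃ S : ℕ → Set L, Monotone S ∧ ∀ e, S e ⊆ W e ∧ W e ⊆ Submodule.span K (S e) ∧
      LinearIndepOn K id (S e) := by
  have step (e : ℕ) (s : Set L) (hs : s ⊆ W e) (hi : LinearIndepOn K id s) :
      ∃ b ⊆ W (e + 1), s ⊆ b ∧ W (e + 1) ⊆ Submodule.span K b ∧ LinearIndepOn K id b :=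
    exists_linearIndepOn_id_extension hi (hs.trans (hW e.le_succ))
  choose! f hf1 hf2 hf3 hf4 using step
  obtain ⟨b, hb1, -, hb3, hb4⟩ := exists_linearIndepOn_id_extension
    (linearIndepOn_empty K (id : L → L)) (Set.empty_subset (W 0))
  let S : ℕ → Set L := fun n => Nat.rec b (fun e s => f e s) n
  have key (e : ℕ) : S e ⊆ W e ∧ W e ⊆ Submodule.span K (S e) ∧ LinearIndepOn K id (S e) := by
    induction e with
    | zero => exact ⟨hb1, hb3, hb4⟩
    | succ e ih => exact ⟨hf1 _ _ ih.1 ih.2.2, hf3 _ _ ih.1 ih.2.2, hf4 _ _ ih.1 ih.2.2⟩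
  exact ⟨S, monotone_nat_of_le_succ fun e => hf2 _ _ (key e).1 (key e).2.2, key⟩

/-- Slicing: if `y` is transcendental over `R` and lies in `K` and in the `R`-span of `V`, the
products of powers of `y` with elements of `V ^ e` that are independent over `K` are independent
over `R`. -/
theorem sum_finrank_pow_le {E R K L : Type*} [Field E] [Field R] [Field K] [Field L]
    [Algebra E R] [Algebra E K] [Algebra E L] [Algebra R K] [Algebra R L] [Algebra K L]
    [IsScalarTower E R L] [IsScalarTower E K L] [IsScalarTower R K L]
    (V : Submodule E L) [FiniteDimensional E V] (h1 : (1 : L) ∈ V) {y : K}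
    (hy : Transcendental R y) (hyV : algebraMap K L y ∈ Submodule.span R (V : Set L)) (d : ℕ) :
    ∑ e ∈ Finset.range (d + 1),
      Module.finrank K (Submodule.span K (V : Set L) ^ e : Submodule K L) ≤
      Module.finrank E (V ^ d : Submodule E L) := by
  have hfin (e : ℕ) := finiteDimensional_pow V e
  have hone : (1 : Submodule E L) ≤ V := Submodule.one_le.2 h1
  obtain ⟨S, hSm, hS⟩ := exists_nested_linearIndepOn (K := K)
    (fun e => ((V ^ e : Submodule E L) : Set L)) fun a b hab => pow_le_pow_right' hone hab
  have hspan (e : ℕ) : Submodule.span K (S e) = Submodule.span K (V : Set L) ^ e := by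
    rw [span_pow_of_tower]
    exact le_antisymm (Submodule.span_mono (hS e).1) (Submodule.span_le.2 (hS e).2.1)
  have hfinS (e : ℕ) : (S e).Finite := by
    have := finiteDimensional_span (R := K) (V ^ e)
    rw [← span_pow_of_tower, ← hspan] at this
    have h2 : LinearIndependent K fun x : S e => (⟨x, Submodule.subset_span x.2⟩ :
        Submodule.span K (S e)) := (hS e).2.2.linearIndependent.of_comp (Submodule.subtype _)
    exact Set.finite_coe_iff.1 h2.finite_of_isNoetherian
  have hcard (e : ℕ) : Nat.card (S e) =
      Module.finrank K (Submodule.span K (V : Set L) ^ e : Submodule K L) := by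
    have := (hfinS e).fintype
    rw [← hspan, finrank_span_set_eq_card (hS e).2.2, Nat.card_eq_fintype_card,
      Set.toFinset_card]
  have (e : ℕ) : Fintype (S e) := (hfinS e).fintype
  let f : (Σ e : Fin (d + 1), S e) → L := fun p => algebraMap K L y ^ (d - p.1 : ℕ) * (p.2 : L)
  have hpow : LinearIndependent R fun n : ℕ => y ^ n := by
    have h := (Polynomial.basisMonomials R).linearIndependent.map'
      (Polynomial.aeval y).toLinearMap
      (LinearMap.ker_eq_bot.2 (transcendental_iff_injective.1 hy))
    have heq : (⇑(Polynomial.aeval y).toLinearMap ∘ ⇑(Polynomial.basisMonomials R)) =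
        fun n : ℕ => y ^ n := by
      ext n
      simp
    rwa [heq] at h
  have hli : LinearIndependent R f := by
    have h := linearIndependent_smul hpow (hS d).2.2.linearIndependent
    let g : (Σ e : Fin (d + 1), S e) → ℕ × S d := fun p =>
      (d - p.1, ⟨p.2, hSm (Nat.le_of_lt_succ p.1.2) p.2.2⟩)
    have hg : Function.Injective g := by
      rintro ⟨⟨a, ha⟩, x⟩ ⟨⟨b, hb⟩, z⟩ h
      simp only [g, Prod.mk.injEq, Subtype.mk.injEq] at h
      obtain rfl : a = b := by omega
      simp only [Sigma.mk.injEq, heq_eq_eq, true_and]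
      exact Subtype.ext h.2
    have := h.comp g hg
    have heq : ((fun p : ℕ × S d => y ^ p.1 • id (p.2 : L)) ∘ g) = f := by
      ext p
      simp [f, g, Algebra.smul_def]
    rwa [heq] at this
  have hmem (p) : f p ∈ Submodule.span R ((V ^ d : Submodule E L) : Set L) := by
    have hp : (d - p.1 : ℕ) + p.1 = d := Nat.sub_add_cancel (Nat.le_of_lt_succ p.1.2)
    have h3 : f p ∈ Submodule.span R (V : Set L) ^ (d - p.1 : ℕ) *
        Submodule.span R (V : Set L) ^ (p.1 : ℕ) := by
      refine Submodule.mul_mem_mul (Submodule.pow_mem_pow _ hyV _) ?_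
      rw [span_pow_of_tower]
      exact Submodule.subset_span ((hS _).1 p.2.2)
    rw [← pow_add, hp, span_pow_of_tower] at h3
    exact h3
  have := finiteDimensional_span (R := R) (V ^ d)
  have h4 : LinearIndependent R fun p => (⟨f p, hmem p⟩ :
      Submodule.span R ((V ^ d : Submodule E L) : Set L)) := hli.of_comp (Submodule.subtype _)
  have h5 := h4.fintype_card_le_finrank.trans (finrank_span_le_finrank (R := R) (V ^ d))
  rw [Fintype.card_sigma] at h5
  refine le_trans (le_of_eq ?_) h5
  rw [Finset.sum_range]
  exact Finset.sum_congr rfl fun e _ => by rw [← hcard, Nat.card_eq_fintype_card]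

theorem exists_algebraicIndependent_isAlgClosed (F : Type u) [Field F] [CharZero F] (n : ℕ) :
    ∃ (L : Type u) (_ : Field L) (_ : CharZero L) (_ : IsAlgClosed L) (_ : Algebra F L)
      (t : Fin n → L), AlgebraicIndependent F t := by
  let L := AlgebraicClosure (FractionRing (MvPolynomial (Fin n) F))
  refine ⟨L, inferInstance, ?_, inferInstance, inferInstance,
    fun i => algebraMap (MvPolynomial (Fin n) F) L (X i), ?_⟩
  · exact (algebraMap F L).charZero_iff (algebraMap F L).injective |>.1 ‹_›
  · have hinj : Function.Injective (algebraMap (MvPolynomial (Fin n) F) L) :=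
      (algebraMap (FractionRing (MvPolynomial (Fin n) F)) L).injective.comp
        (IsFractionRing.injective _ _)
    have := (MvPolynomial.algebraicIndependent_X (Fin n) F).map' (f := IsScalarTower.toAlgHom F
      (MvPolynomial (Fin n) F) L) hinj
    exact this

/-- Slicing by a generic hyperplane section: `L` adjoins to `F` independent coefficients of a
linear combination `y` of a basis of `V`, and `K` is the algebraic closure of `E` with the
coefficients and `y` adjoined. The span of `V` over `K` loses at most one dimension. -/
theorem exists_slice {E F : Type u} [Field E] [Field F] [CharZero E] [CharZero F] [Algebra E F]
    [IsAlgClosed E] (V : Submodule E F) [FiniteDimensional E V] (h1 : (1 : F) ∈ V) {w : ℕ}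
    (D : Fin (w + 2) → Derivation E F F) (v : Fin (w + 2) → F) (hv : ∀ b, v b ∈ V)
    (hD : ∀ a b, D a (v b) = if a = b then 1 else 0) :
    ∃ (K L : Type u) (_ : Field K) (_ : Field L) (_ : CharZero K) (_ : CharZero L)
      (_ : Algebra K L) (_ : IsAlgClosed K) (V' : Submodule K L), FiniteDimensional K V' ∧
      (1 : L) ∈ V' ∧ Module.finrank E V ≤ Module.finrank K V' + 1 ∧
      (∃ (D' : Fin (w + 1) → Derivation K L L) (v' : Fin (w + 1) → L), (∀ b, v' b ∈ V') ∧
        ∀ a b, D' a (v' b) = if a = b then 1 else 0) ∧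
      ∀ d, ∑ e ∈ Finset.range (d + 1), Module.finrank K (V' ^ e : Submodule K L) ≤
        Module.finrank E (V ^ d : Submodule E F) := by
  let n := Module.finrank E V
  let b : Module.Basis (Fin n) E V := Module.finBasis E V
  obtain ⟨L, _, _, _, _, t, ht⟩ := exists_algebraicIndependent_isAlgClosed F n
  let _ : Algebra E L := ((algebraMap F L).comp (algebraMap E F)).toAlgebra
  have : IsScalarTower E F L := IsScalarTower.of_algebraMap_eq' rfl
  let ι : F →ₐ[E] L := IsScalarTower.toAlgHom E F L
  have hι (x : F) : ι x = algebraMap F L x := rfl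
  have hιinj : Function.Injective ι := ι.injective
  let ξ : Fin n → L := fun i => ι (b i)
  have hspanE : Submodule.span E (Set.range ξ) = V.map ι.toLinearMap := by
    rw [← span_range_finBasis V, Submodule.map_span, ← Set.range_comp]
    rfl
  have hξ : LinearIndependent E ξ :=
    (b.linearIndependent.map' V.subtype V.ker_subtype).map' ι.toLinearMap
      (LinearMap.ker_eq_bot.2 hιinj)
  let y₀ : L := ∑ i, t i * ξ i
  let K₀ := IntermediateField.adjoin E (insert y₀ (Set.range t))
  let K := algebraicClosure K₀ L
  have hK₀ (x : L) (hx : x ∈ K₀) : x ∈ K := K.algebraMap_mem ⟨x, hx⟩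
  have hyK : y₀ ∈ K := hK₀ _ (IntermediateField.subset_adjoin _ _ (Set.mem_insert _ _))
  have htK (i) : t i ∈ K :=
    hK₀ _ (IntermediateField.subset_adjoin _ _ (Set.mem_insert_of_mem _ ⟨i, rfl⟩))
  let y : K := ⟨y₀, hyK⟩
  let t' : Fin n → K := fun i => ⟨t i, htK i⟩
  have hS : Submodule.span K (KaehlerDifferential.D E K '' insert y (Set.range t')) = ⊤ := by
    rw [← span_D_algebraicClosure (E := E) (insert y₀ (Set.range t))]
    congr 2
    ext z
    simp [y, t', Subtype.ext_iff, K, K₀]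
  have : IsScalarTower E K L := IsScalarTower.of_algebraMap_eq fun _ => rfl
  have hKalg : IsAlgClosed K := IsAlgClosure.isAlgClosed K₀
  -- the given derivations, extended by zero on the new variables
  have hext (a : Fin (w + 2)) : ∃ D' : Derivation E L L,
      (∀ x, D' (ι x) = ι (D a x)) ∧ ∀ i, D' (t i) = 0 :=
    exists_derivation_extension ((Algebra.linearMap F L).compDer (D a)) ht 0
  choose T hT hTt using hext
  have hextP (i : Fin n) : ∃ D' : Derivation E L L, (∀ x, D' (ι x) = 0) ∧
      ∀ j, D' (t j) = if i = j then 1 else 0 :=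
    exists_derivation_extension (0 : Derivation E F L) ht _
  choose P hP hPt using hextP
  have hTy (a) : T a y₀ = ∑ i, t i * ι (D a (b i)) := by
    simp only [y₀, map_sum, Derivation.leibniz, ξ, hT, hTt, smul_eq_mul, mul_zero,
      add_zero]
  have hcoord (x : F) (hx : x ∈ V) : x = ∑ i, b.repr ⟨x, hx⟩ i • (b i : F) := by
    have := congrArg Subtype.val (b.sum_repr ⟨x, hx⟩)
    rw [Submodule.coe_sum] at this
    exact this.symm
  have hη (a) : T a y₀ ≠ 0 := by
    rw [hTy]
    intro h
    have h2 := Fintype.linearIndependent_iff.1 ht.linearIndependent (fun i => D a (b i)) (by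
      rw [← h]
      exact Finset.sum_congr rfl fun i _ => by rw [Algebra.smul_def, mul_comm]; rfl)
    have h3 := hD a a
    rw [hcoord _ (hv a), map_sum, if_pos rfl] at h3
    simp [Derivation.map_smul, h2] at h3
  let D₀ : Derivation E L L := (T 0 y₀)⁻¹ • T 0
  let Δ (a : Fin (w + 1)) : Derivation E L L := T a.succ - T a.succ y₀ • D₀
  have hD₀y : D₀ y₀ = 1 := inv_mul_cancel₀ (hη 0)
  have hD₀t (i) : D₀ (t i) = 0 := by simp [D₀, hTt]
  have hΔK (a) (x : K) : Δ a (algebraMap K L x) = 0 := by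
    refine derivation_eq_zero_of_span hS ((Δ a).compAlgebraMap K) ?_ x
    rintro s (hs | ⟨i, rfl⟩)
    · rw [hs]
      change Δ a y₀ = 0
      simp [Δ, hD₀y]
    · change Δ a (t i) = 0
      simp [Δ, hTt, hD₀t]
  have hΔv (a c) : Δ a (ι (v c.succ)) = if a = c then 1 else 0 := by
    have h0 : (0 : Fin (w + 2)) ≠ c.succ := (Fin.succ_ne_zero c).symm
    simp only [Δ, D₀, Derivation.sub_apply, Derivation.smul_apply, hT, hD, h0, if_false,
      Fin.succ_inj]
    split_ifs <;> simp
  have hVK : Submodule.span K ((V.map ι.toLinearMap : Submodule E L) : Set L) =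
      Submodule.span K (Set.range ξ) := by
    rw [← hspanE, Submodule.span_span_of_tower]
  have hdim : Fintype.card (Fin n) ≤ Module.finrank K (Submodule.span K (Set.range ξ)) + 1 := by
    refine card_le_finrank_span_add_one t' y hS ξ hξ rfl (fun i => b.repr ⟨1, h1⟩ i) ?_ D₀ hD₀t
      hD₀y P (fun i j => hP i _) (fun i j => hPt i j) ?_
    · have := congrArg ι (hcoord 1 h1)
      rw [map_one, map_sum] at this
      rw [this]
      exact Finset.sum_congr rfl fun i _ => (ι.toLinearMap.map_smul _ _).symm
    · by_contra! h
      have h2 := hΔv 0 0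
      rw [hcoord _ (hv _), map_sum, map_sum, if_pos rfl] at h2
      refine zero_ne_one (α := L) ?_
      rw [← h2]
      refine (Finset.sum_eq_zero fun i _ => ?_).symm
      have hs : ι (b.repr ⟨_, hv (0 : Fin (w + 1)).succ⟩ i • (b i : F)) =
          b.repr ⟨_, hv (0 : Fin (w + 1)).succ⟩ i • ξ i := ι.toLinearMap.map_smul _ _
      rw [hs, Derivation.map_smul]
      obtain ⟨z, hz⟩ := h i
      rw [← hz, hΔK, smul_zero]
  choose D' hD' using fun a => exists_derivation_of_vanishing (Δ a) (hΔK a)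
  have : FiniteDimensional E (V.map ι.toLinearMap) := inferInstance
  refine ⟨K, L, inferInstance, inferInstance, inferInstance, inferInstance, inferInstance,
    hKalg, Submodule.span K ((V.map ι.toLinearMap : Submodule E L) : Set L),
    finiteDimensional_span _, Submodule.subset_span ⟨1, h1, map_one ι⟩, ?_,
    ⟨D', fun a => ι (v a.succ), fun c => Submodule.subset_span ⟨_, hv _, rfl⟩,
      fun a c => by rw [hD', hΔv]⟩,
    fun d => ?_⟩
  · rw [hVK]
    rwa [Fintype.card_fin] at hdim
  · have hpow : V.map ι.toLinearMap ^ d = (V ^ d).map ι.toLinearMap :=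
      (Submodule.map_pow V ι d).symm
    have hfr : Module.finrank E (V ^ d : Submodule E F) =
        Module.finrank E (V.map ι.toLinearMap ^ d : Submodule E L) := by
      rw [hpow]
      exact (Submodule.equivMapOfInjective ι.toLinearMap hιinj _).finrank_eq
    rw [hfr]
    have hone : (1 : L) ∈ V.map ι.toLinearMap := ⟨1, h1, map_one ι⟩
    let R : IntermediateField E K := IntermediateField.adjoin E (Set.range t')
    refine sum_finrank_pow_le (R := R) _ hone (y := y) (fun halg => ?_) ?_ d
    · have := derivation_eq_zero_of_isAlgebraic (K := R) (D₀.compAlgebraMap K) (fun x =>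
        derivation_eq_zero_of_mem_adjoin (D₀.compAlgebraMap K) (by
          rintro _ ⟨i, rfl⟩
          exact hD₀t i) x.2) halg
      change D₀ y₀ = 0 at this
      rw [hD₀y] at this
      exact one_ne_zero this
    · change ∑ i, t i * ξ i ∈ _
      refine Submodule.sum_mem _ fun i _ => ?_
      have hti : t' i ∈ R := IntermediateField.subset_adjoin _ _ ⟨i, rfl⟩
      exact Submodule.smul_mem _ (⟨t' i, hti⟩ : R)
        (Submodule.subset_span ⟨b i, (b i).2, rfl⟩)

/-- A lower bound for the powers of `V`, which corresponds to a nondegenerate variety of dimension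
at least `w + 1` in a projective space of dimension `k`: to the bound for a curve, each further
dimension contributes `k + d - 2`. The dimension enters through `w + 1` derivations over `E` that
are dual to elements of `V`; the induction on it passes to a generic hyperplane section, whose
powers sum up to at most a power of `V`. -/
theorem le_finrank_pow_of_dual_derivations {w : ℕ} : ∀ {E F : Type u} [Field E] [Field F]
    [CharZero E] [CharZero F] [Algebra E F] [IsAlgClosed E] (V : Submodule E F)
    [FiniteDimensional E V] (_ : (1 : F) ∈ V) {k : ℕ} (_ : Module.finrank E V = k + 1)
    (D : Fin (w + 1) → Derivation E F F) (v : Fin (w + 1) → F) (_ : ∀ b, v b ∈ V)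
    (_ : ∀ a b, D a (v b) = if a = b then 1 else 0) {d : ℕ} (_ : 3 ≤ d),
    k * d + 1 + w * (k + d - 2) ≤ Module.finrank E (V ^ d : Submodule E F) := by
  induction w with
  | zero =>
    intro E F _ _ _ _ _ _ V _ h1 k hV D v hv hD d hd
    have := le_finrank_pow V hV d
    omega
  | succ w ih =>
    intro E F _ _ _ _ _ _ V _ h1 k hV D v hv hD d hd
    -- `1` and the `v b` are independent
    have hwk : w + 2 ≤ k := by
      have hli : LinearIndependent E (Fin.cons ⟨1, h1⟩ (fun a => ⟨v a, hv a⟩) :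
          Fin (w + 2 + 1) → V) := by
        rw [Fintype.linearIndependent_iff]
        intro g hg
        rw [Fin.sum_univ_succ] at hg
        have hg' := congrArg Subtype.val hg
        simp only [Fin.cons_zero, Fin.cons_succ, Submodule.coe_add, Submodule.coe_smul,
          Submodule.coe_sum, Submodule.coe_zero] at hg'
        have hs (a : Fin (w + 2)) : g a.succ = 0 := by
          have := congrArg (D a) hg'
          simpa [hD, Derivation.map_smul, Algebra.smul_def] using this
        intro i
        refine Fin.cases ?_ hs i
        simpa [hs, Algebra.smul_def] using hg'
      have := hli.fintype_card_le_finrank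
      rw [Fintype.card_fin, hV] at this
      omega
    obtain ⟨K, L, _, _, _, _, _, _, V', _, h1', hdim, ⟨D', v', hv', hD'⟩, hsum⟩ :=
      exists_slice V h1 D v hv hD
    refine le_trans ?_ (hsum d)
    obtain ⟨j, hj⟩ : ∃ j, Module.finrank K V' = j + 1 ∧ k ≤ j + 1 :=
      ⟨Module.finrank K V' - 1, by omega, by omega⟩
    have hlow (e : ℕ) := le_finrank_pow V' hj.1 e
    have hhigh (e : ℕ) (he : 3 ≤ e) := ih V' h1' hj.1 D' v' hv' hD' he
    obtain ⟨k, rfl⟩ : ∃ k', k = k' + 1 := ⟨k - 1, by omega⟩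
    have hjk : k ≤ j := by omega
    induction d, hd using Nat.le_induction with
    | base =>
      simp only [Finset.sum_range_succ, Finset.sum_range_zero]
      have h0 := hlow 0
      have h1 := hlow 1
      have h2 := hlow 2
      have h3 := hhigh 3 le_rfl
      have h4 : w * (k + 1) ≤ w * (j + 3 - 2) := Nat.mul_le_mul_left _ (by omega)
      have h5 : (w + 1) * (k + 1 + 3 - 2) = w * (k + 1) + w + k + 2 := by
        rw [show k + 1 + 3 - 2 = k + 2 by omega]
        ring
      omega
    | succ d hd ihd =>
      rw [Finset.sum_range_succ]
      have h3 := hhigh (d + 1) (by omega)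
      have h4 : w * (k + d - 1) ≤ w * (j + (d + 1) - 2) := Nat.mul_le_mul_left _ (by omega)
      have h5 : k * 4 ≤ j * (d + 1) := Nat.mul_le_mul hjk (by omega)
      have h6 : (k + 1) * (d + 1) + 1 + (w + 1) * (k + 1 + (d + 1) - 2) =
          ((k + 1) * d + 1 + (w + 1) * (k + 1 + d - 2)) + (k + 1 + (w + 1)) := by
        rw [show k + 1 + (d + 1) - 2 = (k + 1 + d - 2) + 1 by omega]
        ring
      rw [h6]
      omega

/-! ### Linear algebra -/

/-- A subspace of a coordinate space projects isomorphically to some coordinate subspace. -/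
theorem exists_bijective_restrict {F n : Type*} [Field F] [Fintype n] (Q : Submodule F (n → F)) :
    ∃ S : Finset n, S.card = Module.finrank F Q ∧
      Function.Bijective fun (x : Q) (s : S) => (x : n → F) s := by
  classical
  let v : n → Module.Dual F Q := fun i => LinearMap.proj i ∘ₗ Q.subtype
  obtain ⟨b, -, -, hb, hli⟩ := exists_linearIndepOn_extension (linearIndepOn_empty F v)
    (Set.empty_subset Set.univ)
  let S := b.toFinset
  let r : Q →ₗ[F] (S → F) := LinearMap.pi fun s => v s
  have hinj : Function.Injective r := by
    rw [← LinearMap.ker_eq_bot, LinearMap.ker_eq_bot']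
    intro x hx
    have h : ∀ φ ∈ Submodule.span F (v '' b), φ x = 0 := by
      intro φ hφ
      induction hφ using Submodule.span_induction with
      | mem φ h =>
        obtain ⟨i, hi, rfl⟩ := h
        exact congrFun hx ⟨i, Set.mem_toFinset.2 hi⟩
      | zero => rfl
      | add a b _ _ ha hb => rw [LinearMap.add_apply, ha, hb, add_zero]
      | smul a b _ hb => rw [LinearMap.smul_apply, hb, smul_zero]
    ext i
    exact h _ (hb ⟨i, Set.mem_univ _, rfl⟩)
  have hle : S.card ≤ Module.finrank F Q := by
    have := hli.linearIndependent.fintype_card_le_finrank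
    rw [Subspace.dual_finrank_eq] at this
    rwa [Set.toFinset_card]
  have hge : Module.finrank F Q ≤ S.card := by
    have := LinearMap.finrank_le_finrank_of_injective hinj
    rwa [Module.finrank_fintype_fun_eq_card, Fintype.card_coe] at this
  refine ⟨S, le_antisymm hle hge, hinj, ?_⟩
  have h : Module.finrank F Q = Module.finrank F (S → F) := by
    rw [Module.finrank_fintype_fun_eq_card, Fintype.card_coe]
    exact le_antisymm hge hle
  exact (LinearMap.injective_iff_surjective_of_finrank_eq_finrank h).1 hinj

/-- Vectors with entries in a finite-dimensional `Ω`-space that lie in a subspace of dimension `q`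
over a larger field form an `Ω`-space no bigger than that of `q`-tuples. -/
theorem finrank_pi_inf_le {Ω F n : Type*} [Field Ω] [Field F] [Algebra Ω F] [Fintype n]
    (A : Submodule Ω F) [FiniteDimensional Ω A] (Q : Submodule F (n → F)) :
    Module.finrank Ω (Submodule.pi Set.univ (fun _ : n => A) ⊓ Q.restrictScalars Ω :
      Submodule Ω (n → F)) ≤ Module.finrank F Q * Module.finrank Ω A := by
  obtain ⟨S, hS, hb⟩ := exists_bijective_restrict Q
  let r : (Submodule.pi Set.univ (fun _ : n => A) ⊓ Q.restrictScalars Ω :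
      Submodule Ω (n → F)) →ₗ[Ω] (S → A) :=
    LinearMap.pi fun s => LinearMap.codRestrict A
      (LinearMap.proj (s : n) ∘ₗ Submodule.subtype _) fun x => x.2.1 s (Set.mem_univ _)
  have hr : Function.Injective r := by
    intro x y h
    have h2 : (⟨x.1, x.2.2⟩ : Q) = ⟨y.1, y.2.2⟩ := hb.1 (funext fun s =>
      congrArg Subtype.val (congrFun h s))
    exact Subtype.ext (congrArg (fun z : Q => (z : n → F)) h2)
  have := LinearMap.finrank_le_finrank_of_injective hr
  rwa [Module.finrank_pi_fintype, Finset.sum_const, Finset.card_univ, Fintype.card_coe, hS,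
    smul_eq_mul] at this

theorem finrank_map_add_finrank_ker {K V W : Type*} [Field K] [AddCommGroup V] [Module K V]
    [AddCommGroup W] [Module K W] (f : V →ₗ[K] W) (U : Submodule K V) [FiniteDimensional K U] :
    Module.finrank K (U.map f) + Module.finrank K (LinearMap.ker f ⊓ U : Submodule K V) =
      Module.finrank K U := by
  have h := LinearMap.finrank_range_add_finrank_ker (f.domRestrict U)
  have h1 : LinearMap.range (f.domRestrict U) = U.map f := by
    ext; simp
  have h2 : (LinearMap.ker (f.domRestrict U)).map U.subtype = LinearMap.ker f ⊓ U := by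
    ext; simp [LinearMap.domRestrict_apply, and_comm]
  rw [h1] at h
  rw [← h2, ← (Submodule.equivMapOfInjective _ U.injective_subtype _).finrank_eq]
  exact h

/-- The image of `g` is bounded by the image of `f` and the image of the kernel of `f`. -/
theorem finrank_range_le_of_ker {K V X Y : Type*} [Field K] [AddCommGroup V] [Module K V]
    [AddCommGroup X] [Module K X] [AddCommGroup Y] [Module K Y] [FiniteDimensional K X]
    [FiniteDimensional K Y] (f : V →ₗ[K] X) (g : V →ₗ[K] Y) :
    Module.finrank K (LinearMap.range g) ≤ Module.finrank K (LinearMap.range f) +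
      Module.finrank K ((LinearMap.ker f).map g) := by
  let R := LinearMap.range (f.prod g)
  have h1 : R.map (LinearMap.fst K X Y) = LinearMap.range f := by
    rw [← LinearMap.range_comp, LinearMap.fst_prod]
  have h2 : R.map (LinearMap.snd K X Y) = LinearMap.range g := by
    rw [← LinearMap.range_comp, LinearMap.snd_prod]
  have h3 := finrank_map_add_finrank_ker (LinearMap.fst K X Y) R
  rw [h1] at h3
  have h4 := Submodule.finrank_map_le (LinearMap.snd K X Y) R
  rw [h2] at h4
  have h5 : LinearMap.ker (LinearMap.fst K X Y) ⊓ R =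
      ((LinearMap.ker f).map g).map (LinearMap.inr K X Y) := by
    ext ⟨x, y⟩
    constructor
    · rintro ⟨h, v, hv⟩
      obtain rfl : f v = x := congrArg Prod.fst hv
      obtain rfl : g v = y := congrArg Prod.snd hv
      have h' : f v = 0 := h
      exact ⟨g v, ⟨v, h, rfl⟩, by simp [h']⟩
    · rintro ⟨_, ⟨v, hv, rfl⟩, h⟩
      have h' : f v = 0 := hv
      rw [← h]
      exact ⟨by simp, v, by simp [h']⟩
  rw [h5, ← (Submodule.equivMapOfInjective _ LinearMap.inr_injective _).finrank_eq] at h3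
  omega

theorem finrank_range_le_finrank_add {K V X Y : Type*} [Field K] [AddCommGroup V] [Module K V]
    [AddCommGroup X] [Module K X] [AddCommGroup Y] [Module K Y] [FiniteDimensional K X]
    (f : V →ₗ[K] X) (g : V →ₗ[K] Y) [FiniteDimensional K (LinearMap.range g)] :
    Module.finrank K (LinearMap.range g) ≤ Module.finrank K X +
      Module.finrank K ((LinearMap.ker f).map g) := by
  have h := finrank_range_le_of_ker f g.rangeRestrict
  rw [LinearMap.range_rangeRestrict, finrank_top] at h
  have h1 : (LinearMap.ker f).map g =
      ((LinearMap.ker f).map g.rangeRestrict).map (Submodule.subtype _) := by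
    rw [← Submodule.map_comp]
    rfl
  rw [h1, ← (Submodule.equivMapOfInjective _ (Submodule.injective_subtype _) _).finrank_eq]
  have := Submodule.finrank_le (LinearMap.range f)
  omega

/-! ### Derivations acting on coefficients -/

theorem finrank_homogeneousSubmodule {σ R : Type*} [Field R] (d : ℕ) :
    Module.finrank R (homogeneousSubmodule σ R d) = Nat.card {m : σ →₀ ℕ // m.degree = d} := by
  rw [homogeneousSubmodule_eq_finsupp_supported,
    (AddMonoidAlgebra.supportedEquivFinsupp _).finrank_eq, Module.finrank, rank_finsupp_self,
    Cardinal.toNat_lift]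
  rfl

instance finiteDimensional_homogeneousSubmodule {σ R : Type*} [Field R] [Finite σ] (d : ℕ) :
    FiniteDimensional R (homogeneousSubmodule σ R d) :=
  (Submodule.fg_iff_finiteDimensional _).1 (homogeneousSubmodule_fg σ R d)

theorem map_aeval_homogeneousSubmodule {σ R F : Type*} [Field R] [Field F] [Algebra R F]
    (x : σ → F) (d : ℕ) :
    (homogeneousSubmodule σ R d).map (aeval x : MvPolynomial σ R →ₐ[R] F).toLinearMap =
      Submodule.span R (Set.range x) ^ d := by
  rw [← homogeneousSubmodule_one_pow, Submodule.map_pow, homogeneousSubmodule_one_eq_span_X,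
    Submodule.map_span, ← Set.range_comp]
  congr 3
  ext i
  simp

/-- The application of a map to the coefficients of a polynomial. -/
noncomputable def mapCoeffs {R : Type*} [CommRing R] {σ : Type*} (D : R → R)
    (f : MvPolynomial σ R) : MvPolynomial σ R :=
  ∑ m ∈ f.support, monomial m (D (coeff m f))

theorem coeff_mapCoeffs {R : Type*} [CommRing R] {σ : Type*} (D : R → R) (h0 : D 0 = 0)
    (f : MvPolynomial σ R) (m : σ →₀ ℕ) : coeff m (mapCoeffs D f) = D (coeff m f) := by
  classical
  rw [mapCoeffs, coeff_sum]
  simp only [coeff_monomial]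
  rw [Finset.sum_ite_eq' f.support m fun m => D (coeff m f)]
  split_ifs with h
  · rfl
  · rw [notMem_support_iff.1 h, h0]

/-- The derivation of a polynomial ring that applies a derivation to the coefficients. -/
noncomputable def coeffDerivation {C R : Type*} (σ : Type*) [CommRing C] [CommRing R] [Algebra C R]
    (D : Derivation C R R) : Derivation C (MvPolynomial σ R) (MvPolynomial σ R) :=
  Derivation.mk'
    { toFun := mapCoeffs D
      map_add' := fun f g => by
        ext m
        simp [coeff_mapCoeffs]
      map_smul' := fun c f => by
        ext m
        simp [coeff_mapCoeffs] }
    fun f g => by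
      classical
      ext m
      simp only [LinearMap.coe_mk, AddHom.coe_mk, smul_eq_mul, coeff_add,
        coeff_mapCoeffs _ D.map_zero, coeff_mul, map_sum, Derivation.leibniz,
        Finset.sum_add_distrib]
      congr 1
      refine Finset.sum_bij' (fun x _ => x.swap) (fun x _ => x.swap) ?_ ?_ ?_ ?_ ?_ <;>
        simp [add_comm]

theorem coeff_coeffDerivation {C R σ : Type*} [CommRing C] [CommRing R] [Algebra C R]
    (D : Derivation C R R) (f : MvPolynomial σ R) (m : σ →₀ ℕ) :
    coeff m (coeffDerivation σ D f) = D (coeff m f) :=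
  coeff_mapCoeffs _ D.map_zero f m

theorem coeffDerivation_C {C R σ : Type*} [CommRing C] [CommRing R] [Algebra C R]
    (D : Derivation C R R) (a : R) :
    coeffDerivation σ D (MvPolynomial.C a) = MvPolynomial.C (D a) := by
  classical
  ext m
  rw [coeff_coeffDerivation, coeff_C, coeff_C]
  split_ifs <;> simp

theorem coeffDerivation_X {C R σ : Type*} [CommRing C] [CommRing R] [Algebra C R]
    (D : Derivation C R R) (i : σ) :
    coeffDerivation σ D (X i : MvPolynomial σ R) = 0 := by
  classical
  ext m
  rw [coeff_coeffDerivation, coeff_X, coeff_zero]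
  split_ifs <;> simp

theorem isHomogeneous_coeffDerivation {C R σ : Type*} [CommRing C] [CommRing R] [Algebra C R]
    (D : Derivation C R R) {f : MvPolynomial σ R} {d : ℕ} (hf : f.IsHomogeneous d) :
    (coeffDerivation σ D f).IsHomogeneous d := by
  intro m hm
  refine hf fun h => hm ?_
  rw [coeff_coeffDerivation, h, map_zero]

theorem coeffDerivation_pderiv {C R σ : Type*} [CommRing C] [CommRing R] [Algebra C R]
    (D : Derivation C R R) (f : MvPolynomial σ R) (i : σ) :
    coeffDerivation σ D (pderiv i f) = pderiv i (coeffDerivation σ D f) := by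
  classical
  induction f using MvPolynomial.induction_on with
  | C a => simp [coeffDerivation_C]
  | add p q hp hq => simp [hp, hq]
  | mul_X p j hp =>
    simp only [Derivation.leibniz, coeffDerivation_X, pderiv_X, map_add, smul_eq_mul, hp, mul_zero,
      zero_add, Pi.single_apply]
    split_ifs <;> simp [add_comm]

/-- The chain rule for a derivation applied to a value of a polynomial. -/
theorem derivation_aeval {C R B σ : Type*} [Fintype σ] [CommRing C] [CommRing R] [CommRing B]
    [Algebra C R] [Algebra R B] [Algebra C B] (D : Derivation C R R) (D' : Derivation C B B)
    (h : ∀ r, D' (algebraMap R B r) = algebraMap R B (D r)) (x : σ → B) (f : MvPolynomial σ R) :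
    D' (aeval x f) = aeval x (coeffDerivation σ D f) + ∑ s, aeval x (pderiv s f) * D' (x s) := by
  classical
  induction f using MvPolynomial.induction_on with
  | C a => simp [coeffDerivation_C, h]
  | add p q hp hq =>
    simp only [map_add, hp, hq, add_mul, Finset.sum_add_distrib]
    ring
  | mul_X p j hp =>
    simp only [map_mul, Derivation.leibniz, coeffDerivation_X, smul_eq_mul, hp, mul_zero,
      zero_add, map_add, aeval_X, pderiv_X, add_mul, Finset.sum_add_distrib, Pi.single_apply]
    simp only [apply_ite (aeval x), map_one, map_zero, mul_ite, mul_one, mul_zero, ite_mul,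
      zero_mul, Finset.sum_ite_eq, Finset.mem_univ, if_true, mul_add, Finset.mul_sum, mul_assoc]
    ring

/-! ### First-order deformations of a form -/

/-- The linear map that sends a derivation to its values on the coefficients of `f`, collected in a
polynomial. Its range is the space of first-order deformations of `f`. -/
noncomputable def derivativeMap (C : Type*) {R σ : Type*} [CommRing C] [CommRing R] [Algebra C R]
    (f : MvPolynomial σ R) : Derivation C R R →ₗ[R] MvPolynomial σ R where
  toFun D := coeffDerivation σ D f
  map_add' D D' := by
    ext m
    simp [coeff_coeffDerivation]
  map_smul' r D := by
    ext m
    simp [coeff_coeffDerivation]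

theorem derivativeMap_apply {C R σ : Type*} [CommRing C] [CommRing R] [Algebra C R]
    (f : MvPolynomial σ R) (D : Derivation C R R) :
    derivativeMap C f D = coeffDerivation σ D f := rfl

/-- The first-order deformations of a form with a singular zero `ξ` vanish at `ξ`, because the
derivations extend to the field of the coordinates of `ξ`. The form has coefficients in `E`, so
that its deformations over `Ω` are spanned by those over `E`, and the vanishing at `ξ` may be
counted over `E`. -/
theorem finrank_range_derivativeMap_add_le {C E Ω F J : Type*} [Field C] [Field E] [Field Ω]
    [Field F] [CharZero E] [Algebra C E] [Algebra C Ω] [Algebra C F] [Algebra E Ω] [Algebra E F]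
    [Algebra Ω F] [IsScalarTower C E Ω] [IsScalarTower C E F] [IsScalarTower E Ω F] [Fintype J]
    [Module.Finite E Ω[E⁄C]] {d : ℕ} (f : MvPolynomial J E) (hf : f.IsHomogeneous d) (ξ : J → F)
    (h0 : aeval ξ f = 0) (h1 : ∀ i, aeval ξ (pderiv i f) = 0) :
    Module.finrank Ω (LinearMap.range (derivativeMap C (map (algebraMap E Ω) f))) +
      Module.finrank E (Submodule.span E (Set.range ξ) ^ d : Submodule E F) ≤
      Nat.card {m : J →₀ ℕ // m.degree = d} := by
  let N := LinearMap.range (derivativeMap C f)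
  have hN : N ≤ LinearMap.ker (aeval ξ : MvPolynomial J E →ₐ[E] F).toLinearMap ⊓
      homogeneousSubmodule J E d := by
    rintro _ ⟨Δ, rfl⟩
    refine ⟨?_, isHomogeneous_coeffDerivation Δ hf⟩
    obtain ⟨D', hD', -⟩ := exists_derivation_extension (L := F)
      ((Algebra.linearMap E F).compDer Δ) (s := (Empty.elim : Empty → F))
      algebraicIndependent_empty_type Empty.elim
    have := derivation_aeval Δ D' hD' ξ f
    simp only [h0, h1, zero_mul, Finset.sum_const_zero, add_zero, map_zero] at this
    exact this.symm
  have hle := finrank_map_add_finrank_ker (aeval ξ : MvPolynomial J E →ₐ[E] F).toLinearMap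
    (homogeneousSubmodule J E d)
  rw [map_aeval_homogeneousSubmodule, finrank_homogeneousSubmodule] at hle
  have hfinN : FiniteDimensional E N :=
    Submodule.finiteDimensional_of_le (hN.trans inf_le_right)
  have hfin2 : FiniteDimensional E
      (LinearMap.ker (aeval ξ : MvPolynomial J E →ₐ[E] F).toLinearMap ⊓
        homogeneousSubmodule J E d : Submodule E (MvPolynomial J E)) :=
    Submodule.finiteDimensional_of_le inf_le_right
  have h2 := Submodule.finrank_mono hN
  let φ : MvPolynomial J E →ₗ[E] MvPolynomial J Ω := (mapAlgHom (Algebra.ofId E Ω)).toLinearMap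
  have hφ (p) : φ p = map (algebraMap E Ω) p := rfl
  have h3 : LinearMap.range (derivativeMap C (map (algebraMap E Ω) f)) ≤
      Submodule.span Ω ((N.map φ : Submodule E (MvPolynomial J Ω)) : Set (MvPolynomial J Ω)) := by
    rintro _ ⟨D, rfl⟩
    let b := Module.finBasis E Ω[E⁄C]
    let Δ (i) : Derivation C E E := (b.coord i).compDer (KaehlerDifferential.D C E)
    let l := (D.compAlgebraMap E).liftKaehlerDifferential
    have hD (x : E) : D (algebraMap E Ω x) = ∑ i, algebraMap E Ω (Δ i x) * l (b i) := by
      have h4 : D (algebraMap E Ω x) = l (KaehlerDifferential.D C E x) :=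
        ((D.compAlgebraMap E).liftKaehlerDifferential_comp_D x).symm
      rw [h4]
      conv_lhs => rw [← b.sum_repr (KaehlerDifferential.D C E x), map_sum]
      refine Finset.sum_congr rfl fun i _ => ?_
      rw [map_smul, Algebra.smul_def]
      rfl
    have h5 : derivativeMap C (map (algebraMap E Ω) f) D =
        ∑ i, l (b i) • φ (derivativeMap C f (Δ i)) := by
      ext m
      simp only [derivativeMap_apply, coeff_coeffDerivation, coeff_map, hD, coeff_sum, coeff_smul,
        hφ, smul_eq_mul, mul_comm]
    rw [h5]
    exact Submodule.sum_mem _ fun i _ => Submodule.smul_mem _ _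
      (Submodule.subset_span ⟨_, ⟨_, rfl⟩, rfl⟩)
  have hfin4 := finiteDimensional_span (R := Ω) (N.map φ)
  have h6 := Submodule.finrank_mono h3
  have h7 := finrank_span_le_finrank (R := Ω) (N.map φ)
  have h8 := Submodule.finrank_map_le φ N
  omega

/-! ### Restriction to a linear subspace -/

section Substitution

variable {Ω F σ : Type*} [Field Ω] [Field F] [Algebra Ω F]
  {J : Finset σ} (A : σ → J → Ω)

/-- The substitution of the linear forms `∑ j, A s j * X j` in the variables of `J` for all
variables. -/
noncomputable def linearSubst : MvPolynomial σ Ω →ₐ[Ω] MvPolynomial J Ω :=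
  aeval fun s => ∑ j, C (A s j) * X j

theorem isHomogeneous_linearSubst {f : MvPolynomial σ Ω} {d : ℕ} (hf : f.IsHomogeneous d) :
    (linearSubst A f).IsHomogeneous d := by
  have := hf.aeval (n := 1) (S := Ω) (fun s => ∑ j, C (A s j) * X j) fun s =>
    IsHomogeneous.sum _ _ _ fun j _ => isHomogeneous_C_mul_X _ _
  rwa [one_mul] at this

theorem aeval_linearSubst {ξ : σ → F} (hξ : ∀ s, ξ s = ∑ j : J, A s j • ξ j)
    (f : MvPolynomial σ Ω) : aeval (fun j : J => ξ j) (linearSubst A f) = aeval ξ f := by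
  have : (aeval fun j : J => ξ j).comp (linearSubst A) = aeval ξ := by
    ext s
    simp [linearSubst, hξ s, Algebra.smul_def]
  rw [← this]
  rfl

theorem linearSubst_X [DecidableEq σ] (hA : ∀ i j : J, A i j = if i = j then 1 else 0) (j : J) :
    linearSubst A (X (j : σ)) = X j := by
  simp [linearSubst, hA]

theorem linearSubst_rename [DecidableEq σ] (hA : ∀ i j : J, A i j = if i = j then 1 else 0)
    (p : MvPolynomial J Ω) : linearSubst A (rename Subtype.val p) = p := by
  have : (linearSubst A).comp (rename Subtype.val) = AlgHom.id Ω (MvPolynomial J Ω) := by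
    ext j
    simp [linearSubst_X A hA]
  exact DFunLike.congr_fun this p

theorem pderiv_linearSubst [Fintype σ] [DecidableEq σ] (f : MvPolynomial σ Ω) (j : J) :
    pderiv j (linearSubst A f) = ∑ s, C (A s j) * linearSubst A (pderiv s f) := by
  induction f using MvPolynomial.induction_on with
  | C a => simp [linearSubst]
  | add p q hp hq => simp only [map_add, hp, hq, mul_add, Finset.sum_add_distrib]
  | mul_X p i hp =>
    have h : pderiv j (linearSubst A (X i)) = C (A i j) := by
      simp [linearSubst, pderiv_X, Pi.single_apply]
    simp only [map_mul, Derivation.leibniz, smul_eq_mul, hp, h, map_add, pderiv_X,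
      Pi.single_apply, apply_ite (linearSubst A), map_zero, mul_ite, mul_one, mul_zero,
      mul_add, Finset.sum_add_distrib, Finset.mul_sum, Finset.sum_ite_eq, Finset.mem_univ, if_true]
    congr 1
    · ring
    · exact Finset.sum_congr rfl fun s _ => by ring

/-- A derivation that kills `A` commutes with the substitution. -/
theorem coeffDerivation_linearSubst [Fintype σ] {C₀ : Type*} [CommRing C₀] [Algebra C₀ Ω]
    (D : Derivation C₀ Ω Ω) (hD : ∀ s j, D (A s j) = 0) (f : MvPolynomial σ Ω) :
    coeffDerivation J D (linearSubst A f) = linearSubst A (coeffDerivation σ D f) := by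
  have := derivation_aeval D (coeffDerivation J D) (fun r => coeffDerivation_C D r)
    (fun s => ∑ j, C (A s j) * X j) f
  refine this.trans ?_
  simp only [map_sum, Derivation.leibniz, coeffDerivation_C, coeffDerivation_X, hD, map_zero,
    smul_zero, add_zero, Finset.sum_const_zero, mul_zero]
  rfl

/-- The gradient at `ξ` in the directions outside `J`. -/
noncomputable def transversalGradient (J : Finset σ) (ξ : σ → F) :
    MvPolynomial σ Ω →ₗ[Ω] ({s // s ∉ J} → F) :=
  LinearMap.pi fun s => (aeval ξ).toLinearMap ∘ₗ (pderiv (s : σ)).toLinearMap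

theorem transversalGradient_apply (ξ : σ → F) (f : MvPolynomial σ Ω) (s : {s // s ∉ J}) :
    transversalGradient J ξ f s = aeval ξ (pderiv (s : σ) f) := rfl

theorem span_range_subst {ξ : σ → F} (hξ : ∀ s, ξ s = ∑ j : J, A s j • ξ j) :
    Submodule.span Ω (Set.range ξ) = Submodule.span Ω (Set.range fun j : J => ξ j) := by
  refine le_antisymm (Submodule.span_le.2 ?_) (Submodule.span_mono ?_)
  · rintro _ ⟨s, rfl⟩
    rw [hξ]
    exact Submodule.sum_mem _ fun j _ => Submodule.smul_mem _ _ (Submodule.subset_span ⟨j, rfl⟩)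
  · rintro _ ⟨j, rfl⟩
    exact ⟨j, rfl⟩

theorem map_linearSubst_homogeneousSubmodule [DecidableEq σ]
    (hA : ∀ i j : J, A i j = if i = j then 1 else 0) (d : ℕ) :
    (homogeneousSubmodule σ Ω d).map (linearSubst A).toLinearMap = homogeneousSubmodule J Ω d := by
  refine le_antisymm ?_ fun p hp => ?_
  · rintro _ ⟨p, hp, rfl⟩
    exact isHomogeneous_linearSubst A hp
  · have hp' : p.IsHomogeneous d := hp
    rw [Submodule.mem_map]
    refine ⟨rename Subtype.val p, hp'.rename_isHomogeneous (f := Subtype.val), ?_⟩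
    exact linearSubst_rename A hA p

/-- The transversal gradient of a form of degree `d + 1` takes values in the `d`-th power of the
span of the coordinates. -/
theorem transversalGradient_mem {ξ : σ → F} (hξ : ∀ s, ξ s = ∑ j : J, A s j • ξ j) {d : ℕ}
    {g : MvPolynomial σ Ω} (hg : g.IsHomogeneous (d + 1)) (s : {s // s ∉ J}) :
    transversalGradient J ξ g s ∈ Submodule.span Ω (Set.range fun j : J => ξ j) ^ d := by
  have : aeval ξ (pderiv (s : σ) g) ∈ Submodule.span Ω (Set.range ξ) ^ d := by
    rw [← map_aeval_homogeneousSubmodule]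
    exact ⟨_, IsHomogeneous.pderiv (n := d + 1) hg, rfl⟩
  rwa [span_range_subst A hξ] at this

/-- All possible values of the transversal gradient occur for forms that vanish on the linear
subspace parametrized by `A`: they are combinations of the equations `X s - ∑ j, A s j * X j`. -/
theorem exists_transversalGradient_eq [Fintype σ] [DecidableEq σ]
    (hA : ∀ i j : J, A i j = if i = j then 1 else 0) {ξ : σ → F}
    (hξ : ∀ s, ξ s = ∑ j : J, A s j • ξ j) {d : ℕ} (x : {s // s ∉ J} → F)
    (hx : ∀ s, x s ∈ Submodule.span Ω (Set.range fun j : J => ξ j) ^ d) :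
    ∃ g : MvPolynomial σ Ω, g.IsHomogeneous (d + 1) ∧ linearSubst A g = 0 ∧
      transversalGradient J ξ g = x := by
  have hx (s) : ∃ p : MvPolynomial J Ω, p.IsHomogeneous d ∧ aeval (fun j : J => ξ j) p = x s := by
    have := hx s
    rw [← map_aeval_homogeneousSubmodule] at this
    exact this
  choose p hp hpx using hx
  let l (s : σ) : MvPolynomial σ Ω := X s - ∑ j : J, C (A s j) * X (j : σ)
  have hl (s) : linearSubst A (l s) = 0 := by
    simp only [l, map_sub, map_sum, map_mul, linearSubst_X A hA]
    simp [linearSubst]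
  have hlξ (s) : aeval ξ (l s) = 0 := by
    simp only [l, map_sub, map_sum, map_mul, aeval_X, aeval_C, hξ s, Algebra.smul_def, sub_self]
  have hlh (s) : (l s).IsHomogeneous 1 :=
    (isHomogeneous_X _ _).sub (IsHomogeneous.sum _ _ _ fun j _ => isHomogeneous_C_mul_X _ _)
  have hld (s t : {s // s ∉ J}) : pderiv (t : σ) (l s) = if s = t then 1 else 0 := by
    have : ∀ j : J, pderiv (t : σ) (X (j : σ) : MvPolynomial σ Ω) = 0 := fun j =>
      pderiv_X_of_ne fun h => t.2 (h ▸ j.2)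
    simp [l, this, pderiv_X, Pi.single_apply, Subtype.ext_iff]
  refine ⟨∑ s : {s // s ∉ J}, l s * rename Subtype.val (p s), ?_, ?_, ?_⟩
  · refine IsHomogeneous.sum _ _ _ fun s _ => ?_
    rw [add_comm]
    exact (hlh s).mul (hp s).rename_isHomogeneous
  · simp [hl]
  · ext t
    rw [transversalGradient_apply, ← hpx t]
    simp only [map_sum, Derivation.leibniz, smul_eq_mul, map_add, map_mul, hlξ, zero_mul,
      zero_add, hld, apply_ite (aeval ξ), map_zero, mul_ite, mul_one, mul_zero,
      Finset.sum_ite_eq', Finset.mem_univ, if_true, aeval_rename]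
    rfl

/-- A bound for the space of forms that vanish on the linear subspace parametrized by `A` and whose
transversal gradient at `ξ` lies in a subspace `Q`. -/
theorem finrank_transversalGradient_mem_add_le [Fintype σ] [DecidableEq σ]
    (hA : ∀ i j : J, A i j = if i = j then 1 else 0)
    {ξ : σ → F} (hξ : ∀ s, ξ s = ∑ j : J, A s j • ξ j)
    (Q : Submodule F ({s // s ∉ J} → F)) (d : ℕ) :
    Module.finrank Ω ((LinearMap.ker (linearSubst A).toLinearMap ⊓ homogeneousSubmodule σ Ω (d + 1))
        ⊓ (Q.restrictScalars Ω).comap (transversalGradient J ξ) : Submodule Ω (MvPolynomial σ Ω)) +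
      Nat.card {m : J →₀ ℕ // m.degree = d + 1} + Fintype.card {s // s ∉ J} *
        Module.finrank Ω (Submodule.span Ω (Set.range fun j : J => ξ j) ^ d : Submodule Ω F) ≤
      Nat.card {m : σ →₀ ℕ // m.degree = d + 1} + Module.finrank F Q *
        Module.finrank Ω (Submodule.span Ω (Set.range fun j : J => ξ j) ^ d : Submodule Ω F) := by
  have h1 := finrank_map_add_finrank_ker (linearSubst A).toLinearMap
    (homogeneousSubmodule σ Ω (d + 1))
  rw [map_linearSubst_homogeneousSubmodule A hA, finrank_homogeneousSubmodule,
    finrank_homogeneousSubmodule] at h1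
  set K := LinearMap.ker (linearSubst A).toLinearMap ⊓ homogeneousSubmodule σ Ω (d + 1) with hK
  set ν := transversalGradient (Ω := Ω) J ξ with hν
  set B : Submodule Ω F := Submodule.span Ω (Set.range fun j : J => ξ j) ^ d with hB
  set K' := K ⊓ (Q.restrictScalars Ω).comap ν with hK'
  have hfinB : FiniteDimensional Ω B := by
    have : FiniteDimensional Ω (Submodule.span Ω (Set.range fun j : J => ξ j)) :=
      .span_of_finite _ (Set.finite_range _)
    exact finiteDimensional_pow _ d
  have hfinK : FiniteDimensional Ω K := Submodule.finiteDimensional_of_le inf_le_right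
  have hfinK' : FiniteDimensional Ω K' := Submodule.finiteDimensional_of_le inf_le_left
  have h3 := finrank_map_add_finrank_ker ν K
  have h4 := finrank_map_add_finrank_ker ν K'
  have h5 : Module.finrank Ω (LinearMap.ker ν ⊓ K' : Submodule Ω (MvPolynomial σ Ω)) ≤
      Module.finrank Ω (LinearMap.ker ν ⊓ K : Submodule Ω (MvPolynomial σ Ω)) := by
    have : FiniteDimensional Ω (LinearMap.ker ν ⊓ K : Submodule Ω (MvPolynomial σ Ω)) :=
      Submodule.finiteDimensional_of_le inf_le_right
    exact Submodule.finrank_mono (inf_le_inf_left _ inf_le_left)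
  let r : ({s // s ∉ J} → B) →ₗ[Ω] ({s // s ∉ J} → F) :=
    LinearMap.pi fun s => B.subtype ∘ₗ LinearMap.proj s
  have hr : Function.Injective r := fun x y h => by
    ext s
    exact congrFun h s
  have hpi : Submodule.pi Set.univ (fun _ : {s // s ∉ J} => B) = LinearMap.range r := by
    ext x
    constructor
    · exact fun hx => ⟨fun s => ⟨x s, hx s (Set.mem_univ _)⟩, rfl⟩
    · rintro ⟨y, rfl⟩ s -
      exact (y s).2
  have h6 : Module.finrank Ω (K'.map ν) ≤ Module.finrank F Q * Module.finrank Ω B := by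
    refine le_trans ?_ (finrank_pi_inf_le B Q)
    have hle : K'.map ν ≤ Submodule.pi Set.univ (fun _ => B) ⊓ Q.restrictScalars Ω := by
      rintro _ ⟨g, ⟨⟨-, hg⟩, hgQ⟩, rfl⟩
      exact ⟨fun s _ => transversalGradient_mem A hξ hg s, hgQ⟩
    have hfin : FiniteDimensional Ω (Submodule.pi Set.univ (fun _ : {s // s ∉ J} => B)) := by
      rw [hpi]
      infer_instance
    have : FiniteDimensional Ω (Submodule.pi Set.univ (fun _ : {s // s ∉ J} => B) ⊓
      Q.restrictScalars Ω : Submodule Ω _) := Submodule.finiteDimensional_of_le inf_le_left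
    exact Submodule.finrank_mono hle
  have h7 : Fintype.card {s // s ∉ J} * Module.finrank Ω B ≤ Module.finrank Ω (K.map ν) := by
    have hle : LinearMap.range r ≤ K.map ν := by
      rintro _ ⟨x, rfl⟩
      obtain ⟨g, hg1, hg2, hg3⟩ := exists_transversalGradient_eq A hA hξ (r x) fun s => (x s).2
      exact ⟨g, ⟨hg2, hg1⟩, hg3⟩
    have h8 := LinearMap.finrank_range_of_inj hr
    rw [Module.finrank_pi_fintype, Finset.sum_const, Finset.card_univ, smul_eq_mul] at h8
    rw [← h8]
    exact Submodule.finrank_mono hle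
  omega

end Substitution

/-! ### Deformations of a form with a nonconstant singular zero -/

/-- The values of derivations at given elements, as a linear map. -/
noncomputable def derivationEval (E : Type*) {F J : Type*} [Field E] [Field F] [Algebra E F]
    (x : J → F) : Derivation E F F →ₗ[F] (J → F) where
  toFun D j := D (x j)
  map_add' _ _ := rfl
  map_smul' _ _ := rfl

/-- The transversal gradients of the deformations of `f` that preserve `A` and the restriction of
`f` lie in the image of the space of values of derivations over `E`. The image has smaller
dimension, since derivations over `Ω` go to zero. -/
theorem exists_submodule_transversalGradient_mem {C E Ω F σ : Type*} [Field C] [Field E] [Field Ω]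
    [Field F] [CharZero Ω] [Algebra C E] [Algebra C Ω] [Algebra C F] [Algebra E Ω] [Algebra E F]
    [Algebra Ω F] [IsScalarTower C E Ω] [IsScalarTower C Ω F] [IsScalarTower E Ω F]
    [Fintype σ] [DecidableEq σ] {J : Finset σ} (A : σ → J → Ω) {ξ : σ → F}
    (hξ : ∀ s, ξ s = ∑ j : J, A s j • ξ j) (f : MvPolynomial σ Ω)
    (h1 : ∀ s, aeval ξ (pderiv s f) = 0) {S : Set E}
    (hS : Submodule.span E (KaehlerDifferential.D C E '' S) = ⊤)
    (hSf : ∀ s ∈ S, ∃ m, coeff m (linearSubst A f) = algebraMap E Ω s)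
    {j₁ : J} (hj₁ : Transcendental Ω (ξ j₁)) :
    ∃ Q : Submodule F ({s // s ∉ J} → F), Module.finrank F Q + 1 ≤
      Module.finrank F (LinearMap.range (derivationEval E fun j : J => ξ j)) ∧
      ∀ D : Derivation C Ω Ω, (∀ s j, D (A s j) = 0) → coeffDerivation J D (linearSubst A f) = 0 →
        transversalGradient J ξ (coeffDerivation σ D f) ∈ Q := by
  set W := LinearMap.range (derivationEval E fun j : J => ξ j) with hW
  let H : (J → F) →ₗ[F] ({s // s ∉ J} → F) := LinearMap.pi fun t =>
    -∑ s, aeval ξ (pderiv s (pderiv (t : σ) f)) • ∑ i : J, algebraMap Ω F (A s i) •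
      LinearMap.proj i
  have hH (u : J → F) (t) : H u t = -∑ s, aeval ξ (pderiv s (pderiv (t : σ) f)) *
      ∑ i : J, algebraMap Ω F (A s i) * u i := by
    simp [H]
    simp only [Algebra.smul_def]
  have hξ' (D : Derivation C Ω Ω) (D' : Derivation C F F)
      (hD' : ∀ x, D' (algebraMap Ω F x) = algebraMap Ω F (D x)) (hD : ∀ s j, D (A s j) = 0)
      (t : {s // s ∉ J}) : aeval ξ (coeffDerivation σ D (pderiv (t : σ) f)) =
        H (fun j : J => D' (ξ j)) t := by
    have := derivation_aeval D D' hD' ξ (pderiv (t : σ) f)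
    rw [h1, map_zero] at this
    rw [hH, eq_neg_iff_add_eq_zero, this]
    congr 1
    refine Finset.sum_congr rfl fun s _ => ?_
    conv_rhs => rw [hξ s]
    simp [Algebra.smul_def, hD', hD]
  refine ⟨W.map H, ?_, fun D hDA hDf => ?_⟩
  · obtain ⟨Δ, hΔ⟩ := exists_derivation_eq_one hj₁
    have h2 := finrank_map_add_finrank_ker H W
    have h3 : LinearMap.ker H ⊓ W ≠ ⊥ := by
      rw [Submodule.ne_bot_iff]
      refine ⟨fun j : J => Δ (ξ j), ⟨?_, Δ.restrictScalars E, rfl⟩, fun h => ?_⟩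
      · refine LinearMap.mem_ker.2 ?_
        ext t
        refine (hξ' 0 (Δ.restrictScalars C) (fun x => by simp) (fun _ _ => rfl) t).symm.trans ?_
        have : coeffDerivation σ (0 : Derivation C Ω Ω) (pderiv (t : σ) f) = 0 := by
          ext m
          simp [coeff_coeffDerivation]
        rw [this, map_zero]
        rfl
      · have := congrFun h j₁
        rw [hΔ] at this
        exact one_ne_zero this
    have h4 := Submodule.one_le_finrank_iff.2 h3
    omega
  · obtain ⟨D', hD', -⟩ := exists_derivation_extension (L := F)
      ((Algebra.linearMap Ω F).compDer D) (s := (Empty.elim : Empty → F))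
      algebraicIndependent_empty_type Empty.elim
    have hDE (x : E) : D (algebraMap E Ω x) = 0 := by
      refine derivation_eq_zero_of_span hS (D.compAlgebraMap E) (fun s hs => ?_) x
      obtain ⟨m, hm⟩ := hSf s hs
      change D (algebraMap E Ω s) = 0
      rw [← hm, ← coeff_coeffDerivation, hDf, coeff_zero]
    obtain ⟨Δ, hΔ⟩ := exists_derivation_of_vanishing (K := E) D' (fun x => by
      rw [IsScalarTower.algebraMap_apply E Ω F, hD']
      change algebraMap Ω F (D _) = 0
      rw [hDE, map_zero])
    refine ⟨fun j : J => Δ (ξ j), ⟨Δ, rfl⟩, ?_⟩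
    ext t
    rw [transversalGradient_apply, ← coeffDerivation_pderiv, hξ' D D' hD' hDA]
    simp only [hΔ]

/-- The arithmetic of the deformation count. Here `x` is the dimension of the space of all
deformations, `k + 2` that of the linear span of the singular zero, `m` its codimension, and `a` and
`β` are the dimensions of the spaces of deformations of the restriction and of those that preserve
span and restriction. The numbers of monomials on the subspace and in total are `P` and `M`,
the confining space of the transversal gradients has dimension `q`, and `h` and `h'` are the
dimensions of the powers of exponents `d` and `d - 1` of the span of the coordinates. -/
theorem derivative_count {d k m q h h' x a β β' P M : ℕ} (hd : 3 ≤ d)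
    (h1 : x ≤ a + m * (k + 1 + 1) + β) (h2 : β ≤ β') (h3 : β' + P + m * h' ≤ M + q * h')
    (h4 : a + h ≤ P) (h5 : k * d + d + 1 + q * (k + d - 1) ≤ h) (h6 : (k + 1) * (d - 1) + 1 ≤ h')
    (h7 : q ≤ m) (h8 : q ≤ k + 1) : x + (m + (k + 1 + 1) - 1) * (d - 2) ≤ M := by
  obtain ⟨e, rfl⟩ := Nat.exists_eq_add_of_le' hd
  obtain ⟨r, rfl⟩ := Nat.exists_eq_add_of_le h7
  rw [show e + 3 - 1 = e + 2 by omega] at h6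
  rw [show k + (e + 3) - 1 = k + e + 2 by omega] at h5
  rw [show q + r + (k + 1 + 1) - 1 = q + r + k + 1 by omega, show e + 3 - 2 = e + 1 by omega]
  have h9 : r * ((k + 1) * (e + 2) + 1) ≤ r * h' := Nat.mul_le_mul_left _ h6
  have h10 : 0 ≤ r * k * e := Nat.zero_le _
  have h11 : 0 ≤ r * k := Nat.zero_le _
  nlinarith

/-- The bound for the first-order deformations of a form with a singular zero that is not
constant. -/
theorem finrank_range_derivativeMap_le {C Ω F : Type u} {σ : Type*} [Field C] [Field Ω] [Field F]
    [CharZero C] [CharZero Ω] [CharZero F] [IsAlgClosed Ω] [Algebra C Ω] [Algebra C F]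
    [Algebra Ω F] [IsScalarTower C Ω F] [Fintype σ] {d : ℕ} (hd : 3 ≤ d) (f : MvPolynomial σ Ω)
    (hf : f.IsHomogeneous d) (ξ : σ → F) (h0 : aeval ξ f = 0)
    (h1 : ∀ s, aeval ξ (pderiv s f) = 0) {j₀ s₁ : σ} (hj₀ : ξ j₀ = 1)
    (hs₁ : ξ s₁ ∉ Set.range (algebraMap Ω F)) :
    Module.finrank Ω (LinearMap.range (derivativeMap C f)) + (Fintype.card σ - 1) * (d - 2) ≤
      Nat.card {m : σ →₀ ℕ // m.degree = d} := by
  classical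
  obtain ⟨b, -, hjb, hb, hli⟩ := exists_linearIndepOn_extension
    (LinearIndepOn.singleton (R := Ω) (v := ξ) (i := j₀) (by rw [hj₀]; exact one_ne_zero))
    (Set.subset_univ _)
  let J := b.toFinset
  have hj₀J : j₀ ∈ J := Set.mem_toFinset.2 (hjb rfl)
  have hliJ : LinearIndependent Ω fun j : J => ξ j :=
    hli.linearIndependent.comp (fun j : J => (⟨j, Set.mem_toFinset.1 j.2⟩ : b))
      fun x y h => Subtype.ext (congrArg (fun z : b => (z : σ)) h)
  have hA' (s) : ∃ a : J → Ω, ξ s = ∑ j : J, a j • ξ j := by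
    have : ξ s ∈ Submodule.span Ω (Set.range fun j : J => ξ j) := by
      refine Submodule.span_mono ?_ (hb ⟨s, Set.mem_univ _, rfl⟩)
      rintro _ ⟨j, hj, rfl⟩
      exact ⟨⟨j, Set.mem_toFinset.2 hj⟩, rfl⟩
    obtain ⟨a, ha⟩ := (Submodule.mem_span_range_iff_exists_fun Ω).1 this
    exact ⟨a, ha.symm⟩
  choose A' hA' using hA'
  let A : σ → J → Ω := fun s => if h : s ∈ J then Pi.single ⟨s, h⟩ 1 else A' s
  have hA (i j : J) : A i j = if i = j then 1 else 0 := by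
    simp [A, Pi.single_apply, eq_comm]
  have hξ (s) : ξ s = ∑ j : J, A s j • ξ j := by
    by_cases h : s ∈ J
    · simp [A, h, Pi.single_apply]
    · simp only [A, h, dif_neg, not_false_eq_true]
      exact hA' s
  -- a nonconstant coordinate
  obtain ⟨j₁, hj₁⟩ : ∃ j : J, ξ j ∉ Set.range (algebraMap Ω F) := by
    by_contra! h
    refine hs₁ ?_
    choose z hz using h
    refine ⟨∑ j : J, A s₁ j * z j, ?_⟩
    rw [hξ s₁, map_sum]
    exact Finset.sum_congr rfl fun j _ => by rw [map_mul, hz, Algebra.smul_def]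
  have htr : Transcendental Ω (ξ j₁) := fun h =>
    hj₁ (exists_algebraMap_eq_of_isIntegral h.isIntegral)
  obtain ⟨k, hk⟩ : ∃ k, J.card = k + 1 + 1 := by
    have : 1 < J.card := Finset.one_lt_card.2 ⟨j₀, hj₀J, j₁, j₁.2, fun h =>
      hj₁ ⟨1, by rw [← h, hj₀, map_one]⟩⟩
    exact ⟨J.card - 2, by omega⟩
  -- the restriction of `f` and the field `E` of its coefficients
  let f₀ := linearSubst A f
  have hf₀ : f₀.IsHomogeneous d := isHomogeneous_linearSubst A hf
  let S₀ : Set Ω := (fun m => coeff m f₀) '' (f₀.support : Set (J →₀ ℕ))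
  let K₀ := IntermediateField.adjoin C S₀
  let E := algebraicClosure K₀ Ω
  have hE : IsAlgClosed E := IsAlgClosure.isAlgClosed K₀
  have hS := span_D_algebraicClosure (E := C) S₀
  have hT1 : IsScalarTower E Ω F := inferInstance
  have hT2 : IsScalarTower C E Ω := IsScalarTower.of_algebraMap_eq fun _ => rfl
  have hT3 : IsScalarTower C E F := IsScalarTower.of_algebraMap_eq fun x => by
    rw [IsScalarTower.algebraMap_apply C Ω F]
    rfl
  have hfinE : Module.Finite E Ω[E⁄C] := by
    refine ⟨?_⟩
    rw [← hS]
    refine Submodule.fg_span (Set.Finite.image _ ?_)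
    exact (f₀.support.finite_toSet.image _).preimage Subtype.val_injective.injOn
  obtain ⟨f₁, hf₁⟩ : ∃ f₁ : MvPolynomial J E, map (algebraMap E Ω) f₁ = f₀ := by
    refine mem_range_map_iff_coeffs_subset.2 fun x hx => ?_
    obtain ⟨m, hm, rfl⟩ := mem_coeffs_iff.1 hx
    have : coeff m f₀ ∈ K₀ := IntermediateField.subset_adjoin _ _ ⟨m, hm, rfl⟩
    exact ⟨⟨_, E.algebraMap_mem ⟨_, this⟩⟩, rfl⟩
  have hf₁h : f₁.IsHomogeneous d :=
    IsHomogeneous.of_map (f := algebraMap E Ω) (algebraMap E Ω).injective (hf₁ ▸ hf₀)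
  have haev (p : MvPolynomial J E) : aeval (fun j : J => ξ j) p =
      aeval (fun j : J => ξ j) (map (algebraMap E Ω) p) := (aeval_map_algebraMap _ _ _).symm
  have hbound := finrank_range_derivativeMap_add_le (C := C) (Ω := Ω) (F := F) f₁ hf₁h
    (fun j : J => ξ j) (by rw [haev, hf₁, aeval_linearSubst A hξ, h0]) (fun i => by
      rw [haev, ← pderiv_map, hf₁, pderiv_linearSubst, map_sum]
      refine Finset.sum_eq_zero fun s _ => ?_
      rw [map_mul, aeval_linearSubst A hξ, h1, mul_zero])
  rw [hf₁] at hbound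
  obtain ⟨Q, hQ, hQmem⟩ := exists_submodule_transversalGradient_mem (C := C) (E := E) A hξ f h1 hS
    (by
      rintro s ⟨m, -, hm⟩
      exact ⟨m, hm⟩) htr
  -- derivations of `F` over `E` that are dual to some of the coordinates
  have hdual : k * d + d + 1 + Module.finrank F Q * (k + d - 1) ≤ Module.finrank E
      (Submodule.span E (Set.range fun j : J => ξ j) ^ d : Submodule E F) := by
    obtain ⟨T, hT, hTb⟩ := exists_bijective_restrict
      (LinearMap.range (derivationEval E fun j : J => ξ j))
    obtain ⟨w, hw⟩ : ∃ w, T.card = w + 1 := ⟨T.card - 1, by omega⟩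
    have hDex (a : T) : ∃ D : Derivation E F F,
        ∀ c : T, D (ξ (c : J)) = if a = c then 1 else 0 := by
      obtain ⟨⟨_, D, rfl⟩, hx⟩ := hTb.2 fun c => if a = c then 1 else 0
      exact ⟨D, fun c => congrFun hx c⟩
    choose D hD using hDex
    let e := (Finset.equivFinOfCardEq hw).symm
    have hfr : Module.finrank E (Submodule.span E (Set.range fun j : J => ξ j)) = k + 1 + 1 := by
      rw [finrank_span_eq_card (hliJ.restrict_scalars' E), Fintype.card_coe, hk]
    have hfd : FiniteDimensional E (Submodule.span E (Set.range fun j : J => ξ j)) :=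
      .span_of_finite _ (Set.finite_range _)
    have := le_finrank_pow_of_dual_derivations (w := w)
      (Submodule.span E (Set.range fun j : J => ξ j))
      (Submodule.subset_span ⟨⟨j₀, hj₀J⟩, hj₀⟩) hfr (fun a => D (e a)) (fun a => ξ (e a : J))
      (fun a => Submodule.subset_span ⟨_, rfl⟩)
      (fun a c => by rw [hD]; simp) hd
    refine le_trans ?_ this
    have h5 : Module.finrank F Q * (k + d - 1) ≤ w * (k + 1 + d - 2) :=
      Nat.mul_le_mul (by omega) (by omega)
    rw [add_mul k 1 d]
    omega
  have hpow : (k + 1) * (d - 1) + 1 ≤ Module.finrank Ω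
      (Submodule.span Ω (Set.range fun j : J => ξ j) ^ (d - 1) : Submodule Ω F) := by
    have hfd : FiniteDimensional Ω (Submodule.span Ω (Set.range fun j : J => ξ j)) :=
      .span_of_finite _ (Set.finite_range _)
    refine le_finrank_pow _ ?_ _
    rw [finrank_span_eq_card hliJ, Fintype.card_coe, hk]
  have hgrad := finrank_transversalGradient_mem_add_le A hA hξ Q (d - 1)
  rw [Nat.sub_add_cancel (by omega : 1 ≤ d)] at hgrad
  -- split off the deformations that preserve `A` and `f₀`
  have hfr₀ (τ : Type _) [Finite τ] (p : MvPolynomial τ Ω) (hp : p.IsHomogeneous d) :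
      FiniteDimensional Ω (LinearMap.range (derivativeMap C p)) := by
    refine Submodule.finiteDimensional_of_le (S₂ := homogeneousSubmodule τ Ω d) ?_
    rintro _ ⟨D, rfl⟩
    exact isHomogeneous_coeffDerivation D hp
  have hfr₁ := hfr₀ J f₀ hf₀
  have hfr₂ := hfr₀ σ f hf
  let Φ : Derivation C Ω Ω →ₗ[Ω]
      LinearMap.range (derivativeMap C f₀) × ({s // s ∉ J} → J → Ω) :=
    (derivativeMap C f₀).rangeRestrict.prod
      (LinearMap.pi fun s => derivationEval C fun j => A s j)
  have hsplit := finrank_range_le_finrank_add Φ (derivativeMap C f)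
  rw [Module.finrank_prod, Module.finrank_pi_fintype, Finset.sum_const, Finset.card_univ,
    Module.finrank_fintype_fun_eq_card, Fintype.card_coe, hk, smul_eq_mul] at hsplit
  have hker : (LinearMap.ker Φ).map (derivativeMap C f) ≤
      (LinearMap.ker (linearSubst A).toLinearMap ⊓ homogeneousSubmodule σ Ω d) ⊓
        (Q.restrictScalars Ω).comap (transversalGradient J ξ) := by
    rintro _ ⟨D, hD, rfl⟩
    have hD0 : coeffDerivation J D f₀ = 0 :=
      congrArg Subtype.val (congrArg Prod.fst (LinearMap.mem_ker.1 hD))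
    have hD2 := congrArg Prod.snd (LinearMap.mem_ker.1 hD)
    have hDA (s j) : D (A s j) = 0 := by
      by_cases h : s ∈ J
      · rw [hA ⟨s, h⟩ j]
        split_ifs <;> simp
      · exact congrFun (congrFun hD2 ⟨s, h⟩) j
    refine ⟨⟨?_, isHomogeneous_coeffDerivation D hf⟩, hQmem D hDA hD0⟩
    refine LinearMap.mem_ker.2 ?_
    have := coeffDerivation_linearSubst A D hDA f
    exact this.symm.trans hD0
  have hfinK : FiniteDimensional Ω
      ((LinearMap.ker (linearSubst A).toLinearMap ⊓ homogeneousSubmodule σ Ω d) ⊓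
        (Q.restrictScalars Ω).comap (transversalGradient J ξ) :
        Submodule Ω (MvPolynomial σ Ω)) :=
    Submodule.finiteDimensional_of_le (inf_le_left.trans inf_le_right)
  have hβ := Submodule.finrank_mono hker
  have hcard : Fintype.card {s // s ∉ J} + (k + 1 + 1) = Fintype.card σ := by
    rw [Fintype.card_subtype_compl, Fintype.card_coe, hk]
    have := Finset.card_le_univ J
    omega
  have hqm : Module.finrank F Q ≤ Fintype.card {s // s ∉ J} := by
    have := Submodule.finrank_le Q
    rwa [Module.finrank_fintype_fun_eq_card] at this
  have hqk : Module.finrank F Q ≤ k + 1 := by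
    have := Submodule.finrank_le (LinearMap.range (derivationEval E fun j : J => ξ j))
    rw [Module.finrank_fintype_fun_eq_card, Fintype.card_coe, hk] at this
    omega
  clear_value Φ
  rw [← hcard]
  exact derivative_count hd hsplit hβ hgrad hbound hdual hpow hqm hqk

/-! ### Elimination -/

/-- Forms without a common nonzero zero generate all forms of some positive degree. -/
theorem span_degree_eq_of_no_common_zero {κ σ K : Type*} [Field κ] [IsAlgClosed κ] [Finite σ]
    [Finite K] (g : K → MvPolynomial σ κ) (D : K → ℕ) (hg : ∀ k, (g k).IsHomogeneous (D k))
    (h : ∀ v : σ → κ, (∀ k, aeval v (g k) = 0) → v = 0) :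
    ∃ e, 0 < e ∧ ∀ p : MvPolynomial σ κ, p.IsHomogeneous e →
      p ∈ Submodule.span κ (Set.range fun x : (Σ k, {ν : σ →₀ ℕ // ν.degree + D k = e}) =>
        monomial (x.2 : σ →₀ ℕ) (1 : κ) * g x.1) := by
  classical
  have := Fintype.ofFinite K
  let I : Ideal (MvPolynomial σ κ) := Ideal.span (Set.range g)
  have hrad : idealOfVars σ κ ≤ I.radical := by
    rw [← vanishingIdeal_zeroLocus_eq_radical (K := κ), idealOfVars, Ideal.span_le]
    rintro _ ⟨i, rfl⟩ v hv
    rw [h v fun k => hv _ (Ideal.subset_span ⟨k, rfl⟩)]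
    simp
  obtain ⟨n, hn⟩ := Ideal.exists_pow_le_of_le_radical_of_fg hrad (idealOfVars_fg σ κ)
  refine ⟨n + 1, n.succ_pos, fun p hp => ?_⟩
  set U := Submodule.span κ (Set.range fun x : (Σ k, {ν : σ →₀ ℕ // ν.degree + D k = n + 1}) =>
        monomial (x.2 : σ →₀ ℕ) (1 : κ) * g x.1)
  have hpI : p ∈ I := by
    refine hn (Ideal.pow_le_pow_right n.le_succ ((mem_pow_idealOfVars_iff' _ _).2 fun m hm =>
      hp.coeff_eq_zero (by lia)))
  obtain ⟨a, ha⟩ := (Submodule.mem_span_range_iff_exists_fun _).1 hpI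
  have key (k : K) (q : MvPolynomial σ κ) : homogeneousComponent (n + 1) (q * g k) ∈ U := by
    induction q using MvPolynomial.induction_on' with
    | monomial ν r =>
      have hh : (monomial ν r * g k).IsHomogeneous (ν.degree + D k) :=
        (isHomogeneous_monomial r rfl).mul (hg k)
      rw [homogeneousComponent_of_mem hh]
      split_ifs with hdeg
      · have : monomial ν r * g k = r • (monomial ν 1 * g k) := by
          rw [← smul_mul_assoc, smul_monomial, smul_eq_mul, mul_one]
        rw [this]
        exact Submodule.smul_mem _ _ (Submodule.subset_span ⟨⟨k, ν, hdeg.symm⟩, rfl⟩)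
      · exact zero_mem _
    | add p q hp hq => rw [add_mul, map_add]; exact add_mem hp hq
  rw [← homogeneousComponent_eq_self hp, ← ha, map_sum]
  exact Submodule.sum_mem _ fun k _ => key k _

theorem map_coeff_monomial_mul {R S σ : Type*} [CommRing R] [CommRing S] (φ : R →+* S)
    (p : MvPolynomial σ R) (ν μ : σ →₀ ℕ) :
    φ (coeff μ (monomial ν 1 * p)) = coeff μ (monomial ν 1 * map φ p) := by
  rw [← coeff_map, map_mul, map_monomial, map_one]

/-- Elimination: if homogeneous polynomials specialize to polynomials without a common nonzero
zero over an algebraically closed field, the same holds for all specializations at which a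
certain determinant does not vanish. -/
theorem exists_eliminant {R κ σ K : Type*} [CommRing R] [Field κ] [IsAlgClosed κ] [Finite σ]
    [Finite K] (G : K → MvPolynomial σ R) (D : K → ℕ) (hG : ∀ k, (G k).IsHomogeneous (D k))
    (φ : R →+* κ) (h : ∀ v : σ → κ, (∀ k, eval₂ φ v (G k) = 0) → v = 0) :
    ∃ r : R, φ r ≠ 0 ∧ ∀ {κ' : Type u} [Field κ'] (ψ : R →+* κ'), ψ r ≠ 0 →
      ∀ v : σ → κ', (∀ k, eval₂ ψ v (G k) = 0) → v = 0 := by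
  classical
  obtain ⟨e, he, hspan⟩ := span_degree_eq_of_no_common_zero (fun k => map φ (G k)) D
    (fun k => (hG k).map φ) fun v hv => h v fun k => by
      have := hv k
      rwa [aeval_def, eval₂_map, Algebra.algebraMap_self, RingHom.id_comp] at this
  let cols := {μ : σ →₀ ℕ // μ.degree = e}
  have hfin : Finite cols := Finsupp.finite_of_degree_eq e
  have := Fintype.ofFinite cols
  let rows := (Σ k, {ν : σ →₀ ℕ // ν.degree + D k = e})
  let T (x : rows) (μ : cols) : R := coeff (μ : σ →₀ ℕ) (monomial (x.2 : σ →₀ ℕ) 1 * G x.1)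
  let t : rows → cols → κ := fun x μ => φ (T x μ)
  have htop : Submodule.span κ (Set.range t) = ⊤ := by
    let l : MvPolynomial σ κ →ₗ[κ] (cols → κ) := LinearMap.pi fun μ => lcoeff κ (μ : σ →₀ ℕ)
    rw [eq_top_iff]
    rintro u -
    let p : MvPolynomial σ κ := ∑ μ : cols, monomial (μ : σ →₀ ℕ) (u μ)
    have hp : p.IsHomogeneous e := IsHomogeneous.sum _ _ _ fun μ _ => isHomogeneous_monomial _ μ.2
    have hlp : l p = u := by
      ext μ
      change coeff (μ : σ →₀ ℕ) p = u μ
      rw [coeff_sum, Finset.sum_eq_single μ]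
      · simp
      · intro μ' _ hne
        rw [coeff_monomial, if_neg fun h' => hne (Subtype.ext h')]
      · simp
    have := Submodule.mem_map_of_mem (f := l) (hspan p hp)
    rw [hlp, Submodule.map_span, ← Set.range_comp] at this
    have heq : (l ∘ fun x : rows => monomial (x.2 : σ →₀ ℕ) (1 : κ) * map φ (G x.1)) = t := by
      ext x μ
      exact (map_coeff_monomial_mul φ (G x.1) _ _).symm
    rwa [heq] at this
  obtain ⟨b, -, -, hb, hli⟩ := exists_linearIndepOn_extension (linearIndepOn_empty κ t)
    (Set.empty_subset Set.univ)
  have hbtop : ⊤ ≤ Submodule.span κ (Set.range fun x : b => t x) := by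
    rw [← htop, Submodule.span_le, ← Set.image_univ]
    refine hb.trans ?_
    rw [Set.image_eq_range]
  let B := Module.Basis.mk hli.linearIndependent hbtop
  have : Finite b := hli.linearIndependent.finite_of_isNoetherian
  have : Fintype b := Fintype.ofFinite _
  have hcard : Fintype.card cols = Fintype.card b := by
    rw [← Module.finrank_fintype_fun_eq_card κ, Module.finrank_eq_card_basis B]
  let ε : cols ≃ b := Fintype.equivOfCardEq hcard
  refine ⟨(Matrix.of fun μ => T (ε μ)).det, ?_, fun {κ'} _ ψ hψ v hv => ?_⟩
  · rw [RingHom.map_det]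
    have : LinearIndependent κ fun μ => t (ε μ) := hli.linearIndependent.comp ε ε.injective
    have h2 := Matrix.linearIndependent_rows_iff_isUnit.1
      (show LinearIndependent κ (Matrix.of fun μ => t (ε μ)).row from this)
    exact ((Matrix.isUnit_iff_isUnit_det _).1 h2).ne_zero
  · rw [RingHom.map_det] at hψ
    have hz : (ψ.mapMatrix (Matrix.of fun μ => T (ε μ))).mulVec
        (fun μ : cols => aeval v (monomial (μ : σ →₀ ℕ) (1 : κ'))) = 0 := by
      ext μ
      set x : rows := (ε μ : rows)
      have hx : (monomial (x.2 : σ →₀ ℕ) 1 * map ψ (G x.1)).IsHomogeneous e := by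
        have := (isHomogeneous_monomial (1 : κ') (rfl : (x.2 : σ →₀ ℕ).degree = _)).mul
          ((hG x.1).map ψ)
        rwa [x.2.2] at this
      have h0 : aeval v (monomial (x.2 : σ →₀ ℕ) 1 * map ψ (G x.1)) = 0 := by
        have := hv x.1
        rw [map_mul, aeval_def v (map ψ _), eval₂_map, Algebra.algebraMap_self, RingHom.id_comp,
          this, mul_zero]
      have hsum : (monomial (x.2 : σ →₀ ℕ) 1 * map ψ (G x.1)) =
          ∑ μ' : cols, monomial (μ' : σ →₀ ℕ) (ψ (T x μ')) := by
        ext m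
        simp only [T, map_coeff_monomial_mul, coeff_sum, coeff_monomial]
        by_cases hm : m.degree = e
        · rw [Finset.sum_eq_single ⟨m, hm⟩]
          · simp
          · intro μ' _ hne
            exact if_neg fun h' => hne (Subtype.ext h')
          · simp
        · rw [hx.coeff_eq_zero hm, Finset.sum_eq_zero]
          intro μ' _
          exact if_neg fun h' : (μ' : σ →₀ ℕ) = m => hm (h' ▸ μ'.2)
      rw [hsum, map_sum] at h0
      simp only [Matrix.mulVec, dotProduct, Pi.zero_apply]
      rw [← h0]
      refine Finset.sum_congr rfl fun μ' _ => ?_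
      simp [aeval_monomial, x]
    have h3 := Matrix.eq_zero_of_mulVec_eq_zero hψ hz
    ext i
    have h4 := congrFun h3 ⟨Finsupp.single i e, by simp⟩
    simp only [aeval_monomial, map_one, one_mul, Pi.zero_apply] at h4
    have h5 := Finsupp.prod_single_index (a := i) (b := e) (h := fun i k => v i ^ k) (pow_zero _)
    exact pow_eq_zero_iff he.ne' |>.1 (h5.symm.trans h4)

/-! ### Infinite zero loci -/

/-- An infinite zero locus has a nonconstant point over a larger field, namely the generic point of
an infinite component. -/
theorem exists_nonconstant_zero {k : Type u} {σ : Type} [Field k] [Finite σ]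
    (I : Ideal (MvPolynomial σ k)) (hI : (zeroLocus k I).Infinite) :
    ∃ (F : Type u) (_ : Field F) (_ : Algebra k F) (ξ : σ → F), (∀ p ∈ I, aeval ξ p = 0) ∧
      ∃ s, ξ s ∉ Set.range (algebraMap k F) := by
  obtain ⟨p, hp, hinf⟩ : ∃ p ∈ I.minimalPrimes, (zeroLocus k p).Infinite := by
    by_contra! h
    refine hI ((I.finite_minimalPrimes_of_isNoetherianRing.biUnion h).subset fun v hv => ?_)
    let q := RingHom.ker (aeval v : MvPolynomial σ k →ₐ[k] k)
    have hq : q.IsPrime := RingHom.ker_isPrime _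
    obtain ⟨p, hp, hpq⟩ := Ideal.exists_minimalPrimes_le (I := I) (J := q) fun x hx => hv x hx
    exact Set.mem_biUnion hp fun x hx => hpq hx
  have hprime : p.IsPrime := hp.1.1
  let F := FractionRing (MvPolynomial σ k ⧸ p)
  have hF : Function.Injective (algebraMap (MvPolynomial σ k ⧸ p) F) := IsFractionRing.injective _ _
  let ξ (s : σ) : F := algebraMap (MvPolynomial σ k ⧸ p) F (Ideal.Quotient.mk p (X s))
  have hξ (q : MvPolynomial σ k) : aeval ξ q =
      algebraMap (MvPolynomial σ k ⧸ p) F (Ideal.Quotient.mk p q) := by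
    have : aeval ξ = (IsScalarTower.toAlgHom k (MvPolynomial σ k ⧸ p) F).comp
        (Ideal.Quotient.mkₐ k p) := by
      ext s
      simp [ξ]
    rw [this]
    rfl
  refine ⟨F, inferInstance, inferInstance, ξ, fun q hq => ?_, ?_⟩
  · rw [hξ, Ideal.Quotient.eq_zero_iff_mem.2 (hp.1.2 hq), map_zero]
  · by_contra! h
    choose a ha using h
    refine hinf ((Set.finite_singleton a).subset fun v hv => ?_)
    ext s
    have : X s - C (a s) ∈ p := by
      rw [← Ideal.Quotient.eq_zero_iff_mem]
      apply hF
      rw [← hξ, map_zero, map_sub, aeval_X, aeval_C, ha, sub_self]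
    have := hv _ this
    simpa [sub_eq_zero] using this

/-- A projective variety that misses a hyperplane is finite: at a nonconstant point of the affine
chart given by the hyperplane, the powers of the span of the coordinates would stop growing, which
makes the coordinates integral over the base field. -/
theorem finite_of_no_common_zero {κ : Type u} {σ K : Type} [Field κ] [IsAlgClosed κ] [Fintype σ]
    [Finite K] (g : K → MvPolynomial σ κ) (D : K → ℕ) (hg : ∀ k, (g k).IsHomogeneous (D k))
    (l : σ → κ) (h : ∀ v : σ → κ, (∀ k, aeval v (g k) = 0) → ∑ i, l i * v i = 0 → v = 0) :
    {v : σ → κ | (∀ k, aeval v (g k) = 0) ∧ ∑ i, l i * v i = 1}.Finite := by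
  by_contra hinf
  let L : MvPolynomial σ κ := ∑ i, C (l i) * X i
  have hL : L.IsHomogeneous 1 := IsHomogeneous.sum _ _ _ fun i _ => isHomogeneous_C_mul_X _ _
  obtain ⟨F, _, _, ξ, hξ, s, hs⟩ := exists_nonconstant_zero
    (Ideal.span (insert (L - 1) (Set.range g))) (Set.Infinite.mono (fun v hv => by
      rw [zeroLocus_span]
      rintro _ (rfl | ⟨k, rfl⟩)
      · simp [L, hv.2]
      · exact hv.1 k) hinf)
  have hξg (k) : aeval ξ (g k) = 0 :=
    hξ _ (Ideal.subset_span (Set.mem_insert_of_mem _ ⟨k, rfl⟩))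
  have hξL : aeval ξ L = 1 := by
    have := hξ _ (Ideal.subset_span (Set.mem_insert _ _))
    rwa [map_sub, map_one, sub_eq_zero] at this
  obtain ⟨e, he, hspan⟩ := span_degree_eq_of_no_common_zero
    (fun k : Option K => k.elim L g) (fun k => k.elim 1 D)
    (by rintro (_ | k); exacts [hL, hg k]) fun v hv => h v (fun k => hv (some k)) (by
      simpa [L] using hv none)
  let V : Submodule κ F := Submodule.span κ (Set.range ξ)
  -- the powers of `V` become constant
  have hle : V ^ e ≤ V ^ (e - 1) := by
    rw [← map_aeval_homogeneousSubmodule]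
    rintro _ ⟨p, hp, rfl⟩
    have hp' := Submodule.mem_map_of_mem (f := (aeval ξ : MvPolynomial σ κ →ₐ[κ] F).toLinearMap)
      (hspan p hp)
    rw [Submodule.map_span] at hp'
    refine Submodule.span_le.2 ?_ hp'
    rintro _ ⟨_, ⟨⟨k, ν, hν⟩, rfl⟩, rfl⟩
    rcases k with _ | k
    · change aeval ξ (monomial ν 1 * L) ∈ V ^ (e - 1)
      rw [map_mul, hξL, mul_one, ← map_aeval_homogeneousSubmodule]
      refine ⟨_, isHomogeneous_monomial 1 ?_, rfl⟩
      change ν.degree + 1 = e at hν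
      omega
    · change aeval ξ (monomial ν 1 * g k) ∈ V ^ (e - 1)
      rw [map_mul, hξg, mul_zero]
      exact zero_mem _
  refine hs (exists_algebraMap_eq_of_isIntegral
    (isIntegral_of_smul_mem_submodule (V ^ (e - 1)) ?_ ?_ _ fun n hn => hle ?_))
  · have h1 : (1 : F) ∈ V := by
      rw [← hξL, ← pow_one V, ← map_aeval_homogeneousSubmodule]
      exact ⟨L, hL, rfl⟩
    rw [Submodule.ne_bot_iff]
    exact ⟨1, one_pow (M := F) (e - 1) ▸ Submodule.pow_mem_pow _ h1 _, one_ne_zero⟩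
  · exact (Submodule.fg_span (Set.finite_range ξ)).pow _
  · rw [← Nat.sub_add_cancel he, pow_succ', smul_eq_mul]
    exact Submodule.mul_mem_mul (Submodule.subset_span ⟨s, rfl⟩) hn

/-! ### Singular zeros of forms -/

/-- The system of a form and its partial derivatives, indexed by `none` and by the variables; its
common zeros are the singular zeros of the form. -/
noncomputable def gradSystem {σ R : Type*} [CommRing R] (f : MvPolynomial σ R) :
    Option σ → MvPolynomial σ R
  | none => f
  | some i => pderiv i f

theorem isHomogeneous_gradSystem {σ R : Type*} [CommRing R] {f : MvPolynomial σ R} {d : ℕ}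
    (hf : f.IsHomogeneous d) (k : Option σ) :
    (gradSystem f k).IsHomogeneous (k.elim d fun _ => d - 1) := by
  cases k with
  | none => exact hf
  | some i => exact hf.pderiv

theorem map_gradSystem {σ R S : Type*} [CommRing R] [CommRing S] (φ : R →+* S)
    (f : MvPolynomial σ R) (k : Option σ) :
    map φ (gradSystem f k) = gradSystem (map φ f) k := by
  cases k with
  | none => rfl
  | some i => exact (pderiv_map).symm

/-- The monomials of degree `d`. -/
abbrev MonomialOfDegree (σ : Type*) (d : ℕ) : Type _ := {m : σ →₀ ℕ // m.degree = d}

noncomputable instance MonomialOfDegree.fintype {σ : Type*} [Finite σ] {d : ℕ} :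
    Fintype (MonomialOfDegree σ d) :=
  have : Finite (MonomialOfDegree σ d) := Finsupp.finite_of_degree_eq d
  Fintype.ofFinite _

/-- The form of degree `d` with given coefficients. -/
noncomputable def formOf {σ R : Type*} [CommRing R] [Finite σ] {d : ℕ}
    (c : MonomialOfDegree σ d → R) : MvPolynomial σ R :=
  ∑ m : MonomialOfDegree σ d, monomial (m : σ →₀ ℕ) (c m)

section formOf

variable {σ R S : Type*} [CommRing R] [CommRing S] [Finite σ] {d : ℕ} (c : MonomialOfDegree σ d → R)

theorem isHomogeneous_formOf : (formOf c).IsHomogeneous d :=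
  IsHomogeneous.sum _ _ _ fun m _ => isHomogeneous_monomial _ m.2

theorem map_formOf (φ : R →+* S) : map φ (formOf c) = formOf fun m => φ (c m) := by
  simp [formOf, map_monomial]

theorem coeff_formOf (m : MonomialOfDegree σ d) : coeff (m : σ →₀ ℕ) (formOf c) = c m := by
  classical
  rw [formOf, coeff_sum, Finset.sum_eq_single m]
  · simp
  · intro m' _ hne
    rw [coeff_monomial, if_neg fun h => hne (Subtype.ext h)]
  · simp

theorem formOf_coeff {f : MvPolynomial σ R} (hf : f.IsHomogeneous d) :
    formOf (fun m : MonomialOfDegree σ d => coeff (m : σ →₀ ℕ) f) = f := by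
  ext m
  by_cases hm : m.degree = d
  · exact coeff_formOf _ ⟨m, hm⟩
  · rw [hf.coeff_eq_zero hm, (isHomogeneous_formOf _).coeff_eq_zero hm]

end formOf

theorem aeval_smul_of_isHomogeneous {σ R A : Type*} [CommRing R] [CommRing A] [Algebra R A]
    {f : MvPolynomial σ R} {n : ℕ} (hf : f.IsHomogeneous n) (a : A) (v : σ → A) :
    aeval (a • v) f = a ^ n * aeval v f := by
  rw [aeval_def, aeval_def, eval₂_eq, eval₂_eq, Finset.mul_sum]
  refine Finset.sum_congr rfl fun m hm => ?_
  have hm' : ∑ i ∈ m.support, m i = n := by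
    by_contra h
    exact mem_support_iff.1 hm (hf.coeff_eq_zero h)
  simp only [Pi.smul_apply, smul_eq_mul, mul_pow, Finset.prod_mul_distrib,
    Finset.prod_pow_eq_pow_sum, hm']
  ring

/-- A linear form over an infinite field that does not vanish at finitely many given vectors. -/
theorem exists_linear_ne_zero {k κ σ : Type*} [Field k] [Infinite k] [Field κ] [Algebra k κ]
    [Fintype σ] (T : Set (σ → κ)) (hT : T.Finite) (h0 : ∀ v ∈ T, v ≠ 0) :
    ∃ l : σ → k, ∀ v ∈ T, ∑ i, algebraMap k κ (l i) * v i ≠ 0 := by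
  classical
  let φ (v : σ → κ) : (σ → k) →ₗ[k] κ := Fintype.linearCombination k v
  have hφ (v : σ → κ) (l : σ → k) : φ v l = ∑ i, algebraMap k κ (l i) * v i := by
    simp [φ, Fintype.linearCombination_apply, Algebra.smul_def]
  have := Subspace.biUnion_ne_univ_of_top_notMem (k := k) (s := (hT.toFinset.image fun v =>
    LinearMap.ker (φ v))) (by
      intro h
      obtain ⟨v, hv, h⟩ := Finset.mem_image.1 h
      refine h0 v (hT.mem_toFinset.1 hv) (funext fun i => ?_)
      have : φ v (Pi.single i 1) = 0 := by
        rw [← LinearMap.mem_ker, h]; trivial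
      simpa [φ] using this)
  obtain ⟨l, hl⟩ := (Set.ne_univ_iff_exists_notMem _).1 this
  refine ⟨l, fun v hv h => hl (Set.mem_biUnion (x := LinearMap.ker (φ v)) ?_ ?_)⟩
  · exact Finset.mem_image_of_mem _ (hT.mem_toFinset.2 hv)
  · exact (hφ v l).trans h

/-- A projective variety that meets all hyperplanes over an infinite field is infinite in some
affine chart. -/
theorem exists_infinite_chart {k κ σ K : Type*} [Field k] [Infinite k] [Field κ] [Algebra k κ]
    [Fintype σ] (g : K → MvPolynomial σ κ) (D : K → ℕ) (hg : ∀ k, (g k).IsHomogeneous (D k))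
    (h : ∀ l : σ → k, ∃ v : σ → κ, v ≠ 0 ∧ (∀ k, aeval v (g k) = 0) ∧
      ∑ i, algebraMap k κ (l i) * v i = 0) :
    ∃ j, {v : σ → κ | (∀ k, aeval v (g k) = 0) ∧ v j = 1}.Infinite := by
  by_contra! hfin
  obtain ⟨l, hl⟩ := exists_linear_ne_zero (k := k)
    (⋃ j, {v : σ → κ | (∀ k, aeval v (g k) = 0) ∧ v j = 1}) (Set.finite_iUnion hfin) (by
      intro v hv h
      obtain ⟨j, -, hj⟩ := Set.mem_iUnion.1 hv
      rw [h] at hj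
      exact zero_ne_one hj)
  obtain ⟨v, hv0, hv, hlv⟩ := h l
  obtain ⟨j, hj⟩ := Function.ne_iff.1 hv0
  refine hl ((v j)⁻¹ • v) (Set.mem_iUnion.2 ⟨j, fun k => ?_, inv_mul_cancel₀ hj⟩) ?_
  · rw [aeval_smul_of_isHomogeneous (hg k), hv, mul_zero]
  · simp only [Pi.smul_apply, smul_eq_mul, mul_left_comm _ (v j)⁻¹]
    rw [← Finset.mul_sum, hlv, mul_zero]

/-- If a form has no singular zero on a hyperplane, the same holds for all forms whose
coefficients avoid a certain hypersurface. -/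
theorem exists_eliminant_gradSystem {k κ : Type u} {σ : Type*} [Field k] [Field κ]
    [IsAlgClosed κ] [Algebra k κ] [Fintype σ] {d : ℕ}
    (c : MonomialOfDegree σ d → κ) (l : σ → k)
    (h : ∀ v : σ → κ, (∀ k, aeval v (gradSystem (formOf c) k) = 0) →
      ∑ i, algebraMap k κ (l i) * v i = 0 → v = 0) :
    ∃ r : MvPolynomial (MonomialOfDegree σ d) k, aeval c r ≠ 0 ∧
      ∀ a : MonomialOfDegree σ d → k, aeval a r ≠ 0 →
        ∀ v : σ → k, (∀ k, aeval v (gradSystem (formOf a) k) = 0) → ∑ i, l i * v i = 0 → v = 0 := by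
  let R := MvPolynomial (MonomialOfDegree σ d) k
  let U : MvPolynomial σ R := formOf fun m => X m
  let G : Option (Option σ) → MvPolynomial σ R := fun k =>
    k.elim (∑ i, C (C (l i)) * X i) (gradSystem U)
  have key {K : Type u} [Field K] [Algebra k K] (a : MonomialOfDegree σ d → K)
      (v : σ → K) : (∀ x, eval₂ (aeval a : R →ₐ[k] K).toRingHom v (G x) = 0) ↔
        (∀ k, aeval v (gradSystem (formOf a) k) = 0) ∧ ∑ i, algebraMap k K (l i) * v i = 0 := by
    rw [Option.forall, and_comm]
    refine and_congr (forall_congr' fun x => ?_) ?_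
    · have : gradSystem (formOf a) x = map (aeval a : R →ₐ[k] K).toRingHom (gradSystem U x) := by
        rw [map_gradSystem, map_formOf]
        simp
      rw [this, aeval_def, eval₂_map, Algebra.algebraMap_self, RingHom.id_comp]
      rfl
    · change eval₂ _ v (∑ i, C (C (l i)) * X i) = 0 ↔ _
      rw [eval₂_sum]
      simp
  obtain ⟨r, hr, hr'⟩ := exists_eliminant.{u} G
    (fun k => k.elim 1 fun k => k.elim d fun _ => d - 1) (by
      rintro (_ | k)
      · exact IsHomogeneous.sum _ _ _ fun i _ => isHomogeneous_C_mul_X _ _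
      · exact isHomogeneous_gradSystem (isHomogeneous_formOf _) k)
    (aeval c : R →ₐ[k] κ).toRingHom fun v hv => h v ((key c v).1 hv).1 ((key c v).1 hv).2
  exact ⟨r, hr, fun a ha v h1 h2 => hr' (aeval a : R →ₐ[k] k).toRingHom ha v
    ((key a v).2 ⟨h1, h2⟩)⟩

/-! ### Dimension in projective space -/

/-- A finite space with closed points is discrete, hence of dimension at most `0`; an infinite
Noetherian one has an infinite component, which properly contains a closed point. -/
theorem one_le_topologicalKrullDim_iff_infinite {α : Type*} [TopologicalSpace α] [T1Space α]
    [NoetherianSpace α] : 1 ≤ topologicalKrullDim α ↔ Infinite α := by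
  constructor
  · intro h
    by_contra hfin
    rw [not_infinite_iff_finite] at hfin
    exact absurd (h.trans (topologicalKrullDim_zero_of_discreteTopology α)) (by decide)
  · intro h
    obtain ⟨S, hS, hcl, hirr, hU⟩ :=
      NoetherianSpace.exists_finite_set_isClosed_irreducible (isClosed_univ (X := α))
    obtain ⟨W, hW, hinf⟩ : ∃ W ∈ S, W.Infinite := by
      by_contra! hfin
      exact Set.infinite_univ (hU ▸ hS.sUnion hfin)
    obtain ⟨p, hp⟩ := hinf.nonempty
    refine Order.one_le_krullDim_iff.2 ⟨⟨{p}, isIrreducible_singleton, isClosed_singleton⟩,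
      ⟨W, hirr W hW, hcl W hW⟩, ?_⟩
    refine lt_of_le_of_ne (Set.singleton_subset_iff.2 hp) fun h => ?_
    have : ({p} : Set α) = W := congrArg IrreducibleCloseds.carrier h
    exact hinf (this ▸ Set.finite_singleton p)

theorem ProjSpace.isClosed_iff {N : ℕ} {Z : Set (ProjSpace N)} : IsClosed Z ↔
    ∃ S : Set (MvPolynomial (Fin (N + 1)) ℂ),
      (∀ g ∈ S, ∃ n, g.IsHomogeneous n) ∧ Z = projZeros S := by
  rw [← isOpen_compl_iff]
  change Zᶜᶜ ∈ {Z | ∃ S : Set (MvPolynomial (Fin (N + 1)) ℂ),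
      (∀ g ∈ S, ∃ n, g.IsHomogeneous n) ∧ Z = projZeros S} ↔ _
  rw [compl_compl]
  rfl

theorem ProjSpace.eq_of_smul_rep {N : ℕ} {p q : ProjSpace N} {a : ℂ}
    (h : a • Projectivization.rep p = Projectivization.rep q) : q = p :=
  (Projectivization.mk_rep q).symm.trans
    (((Projectivization.mk_eq_mk_iff' ℂ _ _ _ (Projectivization.rep_nonzero p)).2 ⟨a, h⟩).trans
      (Projectivization.mk_rep p))

instance ProjSpace.t1Space (N : ℕ) : T1Space (ProjSpace N) where
  t1 p := by
    let v : Fin (N + 1) → ℂ := Projectivization.rep p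
    refine ProjSpace.isClosed_iff.2 ⟨Set.range fun x : Fin (N + 1) × Fin (N + 1) =>
      C (v x.1) * X x.2 - C (v x.2) * X x.1, ?_, ?_⟩
    · rintro _ ⟨x, rfl⟩
      exact ⟨1, (isHomogeneous_C_mul_X _ _).sub (isHomogeneous_C_mul_X _ _)⟩
    · ext q
      simp only [projZeros, VanishesAt, Set.forall_mem_range, Set.mem_singleton_iff,
        Set.mem_ofPred_eq, map_sub, map_mul, eval_C, eval_X]
      constructor
      · rintro rfl x
        exact sub_eq_zero.2 (mul_comm _ _)
      · intro h
        obtain ⟨j, hj⟩ := Function.ne_iff.1 (Projectivization.rep_nonzero p)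
        refine ProjSpace.eq_of_smul_rep (a := Projectivization.rep q j / v j) (funext fun i => ?_)
        have := h (i, j)
        change _ * v i = _
        have hj' : v j ≠ 0 := hj
        field_simp
        linear_combination this

instance ProjSpace.noetherianSpace (N : ℕ) : NoetherianSpace (ProjSpace N) := by
  refine ((noetherianSpace_TFAE _).out 0 1).2 ?_
  let I (Z : Closeds (ProjSpace N)) : Ideal (MvPolynomial (Fin (N + 1)) ℂ) :=
    Ideal.span {g | (∃ n, g.IsHomogeneous n) ∧ ∀ p ∈ Z, VanishesAt g p}
  have hI (Z : Closeds (ProjSpace N)) {g} (hg : g ∈ I Z) {p} (hp : p ∈ Z) : VanishesAt g p := by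
    have : I Z ≤ RingHom.ker (eval (Projectivization.rep p)) :=
      Ideal.span_le.2 fun g hg => hg.2 p hp
    exact this hg
  have hle {Z W : Closeds (ProjSpace N)} (h : I W ≤ I Z) : Z ≤ W := by
    intro p hp
    obtain ⟨S, hS, hW⟩ := ProjSpace.isClosed_iff.1 W.isClosed
    change p ∈ (W : Set _)
    rw [hW]
    intro g hg
    refine hI Z (h (Ideal.subset_span ⟨hS g hg, fun q hq => ?_⟩)) hp
    have : q ∈ projZeros S := hW ▸ hq
    exact this g hg
  refine StrictAnti.wellFoundedLT (f := I) fun Z W h => lt_of_le_of_ne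
    (Ideal.span_mono fun g hg => ⟨hg.1, fun p hp => hg.2 p (h.le hp)⟩) fun heq => ?_
  exact h.not_ge (hle heq.ge)

theorem mk_mem_sing_iff {N d : ℕ} (f : Forms N d) (v : Fin (N + 1) → ℂ) (hv : v ≠ 0) :
    (Projectivization.mk ℂ v hv : ProjSpace N) ∈ Sing f ↔
      ∀ k, aeval v (gradSystem (f : MvPolynomial (Fin (N + 1)) ℂ) k) = 0 := by
  have hev (g : MvPolynomial (Fin (N + 1)) ℂ) : aeval v g = eval v g := rfl
  rw [Option.forall, hev]
  simp_rw [hev]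
  exact and_congr (vanishesAt_mk_iff f.2 v hv)
    (forall_congr' fun i => vanishesAt_mk_iff f.2.pderiv v hv)

/-- A projective variety has positive dimension if and only if it meets every hyperplane. -/
theorem mem_singDimGE_one_iff {N d : ℕ} (f : Forms N d) : f ∈ SingDimGE 1 N d ↔
    ∀ l : Fin (N + 1) → ℂ, ∃ v : Fin (N + 1) → ℂ, v ≠ 0 ∧
      (∀ k, aeval v (gradSystem (f : MvPolynomial (Fin (N + 1)) ℂ) k) = 0) ∧
        ∑ i, l i * v i = 0 := by
  have h1 : f ∈ SingDimGE 1 N d ↔ (Sing f).Infinite := by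
    rw [← Set.infinite_coe_iff, ← one_le_topologicalKrullDim_iff_infinite]
    exact Iff.rfl
  have hg := isHomogeneous_gradSystem (f := (f : MvPolynomial (Fin (N + 1)) ℂ)) f.2
  rw [h1]
  constructor
  · intro hinf l
    by_contra! h
    have hfin := finite_of_no_common_zero (gradSystem (f : MvPolynomial (Fin (N + 1)) ℂ)) _ hg l
      fun v hv hl => by
        by_contra h0
        exact h v h0 hv hl
    have hrep (p : ProjSpace N) (hp : p ∈ Sing f) : ∀ k, aeval (Projectivization.rep p)
        (gradSystem (f : MvPolynomial (Fin (N + 1)) ℂ) k) = 0 := by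
      refine (mk_mem_sing_iff f _ (Projectivization.rep_nonzero p)).1 ?_
      exact (Projectivization.mk_rep p).symm ▸ hp
    let a (p : ProjSpace N) : ℂ := (∑ i, l i * Projectivization.rep p i)⁻¹
    have ha (p : ProjSpace N) (hp : p ∈ Sing f) : a p ≠ 0 :=
      inv_ne_zero (h _ (Projectivization.rep_nonzero p) (hrep p hp))
    refine hinf (Set.Finite.of_finite_image (f := fun p => a p • Projectivization.rep p)
      (hfin.subset ?_) fun p hp q hq hpq => ?_)
    · rintro _ ⟨p, hp, rfl⟩
      refine ⟨fun k => ?_, ?_⟩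
      · rw [aeval_smul_of_isHomogeneous (hg k), hrep p hp, mul_zero]
      · simp only [Pi.smul_apply, smul_eq_mul, mul_left_comm _ (a p)]
        rw [← Finset.mul_sum]
        exact inv_mul_cancel₀ (h _ (Projectivization.rep_nonzero p) (hrep p hp))
    · refine ProjSpace.eq_of_smul_rep (a := (a p)⁻¹ * a q) ?_
      have hpq' : a q • Projectivization.rep q = a p • Projectivization.rep p := hpq.symm
      rw [mul_smul, hpq']
      exact inv_smul_smul₀ (ha p hp) _
  · intro h
    obtain ⟨j, hj⟩ := exists_infinite_chart (k := ℂ)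
      (gradSystem (f : MvPolynomial (Fin (N + 1)) ℂ)) _ hg h
    have h0 (v : Fin (N + 1) → ℂ) (hv : v j = 1) : v ≠ 0 := by
      rintro rfl
      exact zero_ne_one hv
    have := hj.to_subtype
    refine Set.infinite_of_injective_forall_mem (f := fun v : {v : Fin (N + 1) → ℂ |
      (∀ k, aeval v (gradSystem (f : MvPolynomial (Fin (N + 1)) ℂ) k) = 0) ∧ v j = 1} =>
        (Projectivization.mk ℂ v.1 (h0 _ v.2.2) : ProjSpace N)) ?_ fun v =>
          (mk_mem_sing_iff f _ _).2 v.2.1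
    rintro ⟨v, hv, hvj⟩ ⟨w, hw, hwj⟩ heq
    obtain ⟨b, hb⟩ := (Projectivization.mk_eq_mk_iff' ℂ v w _ _).1 heq
    have hb1 : b = 1 := by
      have := congrFun hb j
      simpa [hvj, hwj] using this
    exact Subtype.ext (by simpa [hb1] using hb.symm)

/-! ### Irreducible closed sets of forms -/

/-- The coefficients of a form of degree `d`. -/
noncomputable def Forms.coeffs {N d : ℕ} (f : Forms N d) : MonomialOfDegree (Fin (N + 1)) d → ℂ :=
  fun m => coeff (m : Fin (N + 1) →₀ ℕ) (f : MvPolynomial (Fin (N + 1)) ℂ)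

theorem Forms.formOf_coeffs {N d : ℕ} (f : Forms N d) :
    formOf f.coeffs = (f : MvPolynomial (Fin (N + 1)) ℂ) :=
  formOf_coeff f.2

theorem Forms.exists_coeffs_eq {N d : ℕ} (a : MonomialOfDegree (Fin (N + 1)) d → ℂ) :
    ∃ f : Forms N d, f.coeffs = a :=
  ⟨⟨formOf a, isHomogeneous_formOf a⟩, funext fun m => coeff_formOf a m⟩

/-- The closed sets of `Forms N d` are given by equations in the coefficients of the monomials of
degree `d`. -/
theorem Forms.isClosed_iff {N d : ℕ} {Z : Set (Forms N d)} : IsClosed Z ↔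
    ∃ S : Set (MvPolynomial (MonomialOfDegree (Fin (N + 1)) d) ℂ),
      Z = {f | ∀ F ∈ S, aeval f.coeffs F = 0} := by
  have h : IsClosed Z ↔ ∃ S, Z = coeffZeros S := by
    rw [← isOpen_compl_iff]
    change Zᶜᶜ ∈ {Z | ∃ S, Z = coeffZeros S} ↔ _
    rw [compl_compl]
    rfl
  rw [h]
  constructor
  · rintro ⟨S, rfl⟩
    let τ : MvPolynomial (Fin (N + 1) →₀ ℕ) ℂ →ₐ[ℂ]
        MvPolynomial (MonomialOfDegree (Fin (N + 1)) d) ℂ :=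
      aeval fun m => if h : m.degree = d then X ⟨m, h⟩ else 0
    have hτ (f : Forms N d) (F) : aeval f.coeffs (τ F) =
        eval (fun m => coeff m (f : MvPolynomial (Fin (N + 1)) ℂ)) F := by
      rw [← AlgHom.comp_apply, comp_aeval]
      change _ = aeval (fun m => coeff m (f : MvPolynomial (Fin (N + 1)) ℂ)) F
      congr 2
      ext m
      split_ifs with hm
      · rw [aeval_X]
        rfl
      · rw [map_zero, f.2.coeff_eq_zero hm]
    refine ⟨τ '' S, Set.ext fun f => ?_⟩
    simp only [Set.mem_ofPred_eq, Set.forall_mem_image, hτ]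
    rfl
  · rintro ⟨S, rfl⟩
    refine ⟨rename Subtype.val '' S, Set.ext fun f => ?_⟩
    simp only [coeffZeros, Set.mem_ofPred_eq, Set.forall_mem_image, eval_rename]
    rfl

theorem isClosed_singDimGE_one (N d : ℕ) : IsClosed (SingDimGE 1 N d) := by
  -- the equations come from the hyperplanes: each form outside the set has no singular zero on
  -- some hyperplane, and this is detected by an eliminant
  refine Forms.isClosed_iff.2 ⟨{r | ∃ l : Fin (N + 1) → ℂ,
    ∀ a : MonomialOfDegree (Fin (N + 1)) d → ℂ, aeval a r ≠ 0 →
      ∀ v : Fin (N + 1) → ℂ, (∀ k, aeval v (gradSystem (formOf a) k) = 0) →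
        ∑ i, l i * v i = 0 → v = 0}, Set.ext fun f => ?_⟩
  rw [mem_singDimGE_one_iff]
  constructor
  · rintro h r ⟨l, hr⟩
    by_contra h0
    obtain ⟨v, hv0, hv, hl⟩ := h l
    exact hv0 (hr _ h0 v (by rwa [Forms.formOf_coeffs]) hl)
  · intro h l
    by_contra! hl
    obtain ⟨r, hr, hr'⟩ := exists_eliminant_gradSystem f.coeffs l fun v hv hv' => by
      by_contra h0
      rw [Forms.formOf_coeffs] at hv
      exact hl v h0 hv hv'
    exact hr (h r ⟨l, hr'⟩)

section genericClosed

variable {N d : ℕ} {L : Type*} [CommRing L] [IsDomain L] [Algebra ℂ L]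

/-- A polynomial in the coefficients that vanishes at all specializations of `c` vanishes at `c`:
this is the Nullstellensatz. -/
theorem aeval_eq_zero_of_forall_specialization (c : MonomialOfDegree (Fin (N + 1)) d → L)
    (F : MvPolynomial (MonomialOfDegree (Fin (N + 1)) d) ℂ)
    (h : ∀ f : Forms N d, (∀ G : MvPolynomial (MonomialOfDegree (Fin (N + 1)) d) ℂ,
      aeval c G = 0 → aeval f.coeffs G = 0) → aeval f.coeffs F = 0) : aeval c F = 0 := by
  let P := RingHom.ker (aeval c : MvPolynomial _ ℂ →ₐ[ℂ] L)
  have hP : P.IsPrime := RingHom.ker_isPrime _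
  change F ∈ P
  rw [← IsPrime.vanishingIdeal_zeroLocus (K := ℂ) P]
  intro a ha
  obtain ⟨f, rfl⟩ := Forms.exists_coeffs_eq a
  exact h f fun G hG => ha G hG

/-- The closed set of the forms whose coefficients are specializations of `c`, i.e. satisfy all
polynomial equations over `ℂ` that hold for `c`. The coordinates of `c` may lie in any domain. -/
def genericClosed (c : MonomialOfDegree (Fin (N + 1)) d → L) :
    IrreducibleCloseds (Forms N d) where
  carrier := {f | ∀ G : MvPolynomial (MonomialOfDegree (Fin (N + 1)) d) ℂ,
    aeval c G = 0 → aeval f.coeffs G = 0}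
  isClosed' := Forms.isClosed_iff.2 ⟨{G | aeval c G = 0}, rfl⟩
  isIrreducible' := by
    constructor
    · by_contra h
      rw [Set.not_nonempty_iff_eq_empty] at h
      have := aeval_eq_zero_of_forall_specialization c 1 fun f hf =>
        absurd hf (Set.eq_empty_iff_forall_notMem.1 h f)
      rw [map_one] at this
      exact one_ne_zero this
    · rw [isPreirreducible_iff_isClosed_union_isClosed]
      intro Z₁ Z₂ h₁ h₂ h
      obtain ⟨S₁, rfl⟩ := Forms.isClosed_iff.1 h₁
      obtain ⟨S₂, rfl⟩ := Forms.isClosed_iff.1 h₂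
      by_contra! hc
      obtain ⟨hc₁, hc₂⟩ := hc
      simp only [Set.not_subset, Set.mem_ofPred_eq, not_forall] at hc₁ hc₂
      obtain ⟨f₁, hf₁, F₁, hF₁, hne₁⟩ := hc₁
      obtain ⟨f₂, hf₂, F₂, hF₂, hne₂⟩ := hc₂
      have := aeval_eq_zero_of_forall_specialization c (F₁ * F₂) fun f hf => by
        rw [map_mul]
        rcases h hf with h | h
        · rw [h F₁ hF₁, zero_mul]
        · rw [h F₂ hF₂, mul_zero]
      rw [map_mul, mul_eq_zero] at this
      rcases this with h | h
      exacts [hne₁ (hf₁ _ h), hne₂ (hf₂ _ h)]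

theorem genericClosed_lt {L' : Type*} [CommRing L'] [IsDomain L'] [Algebra ℂ L']
    {c : MonomialOfDegree (Fin (N + 1)) d → L} {c' : MonomialOfDegree (Fin (N + 1)) d → L'}
    (h : ∀ G : MvPolynomial (MonomialOfDegree (Fin (N + 1)) d) ℂ, aeval c' G = 0 → aeval c G = 0)
    {F : MvPolynomial (MonomialOfDegree (Fin (N + 1)) d) ℂ} (hF : aeval c F = 0)
    (hF' : aeval c' F ≠ 0) : genericClosed c < genericClosed c' := by
  refine lt_of_le_not_ge (fun f hf G hG => hf G (h G hG)) fun hle => hF' ?_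
  exact aeval_eq_zero_of_forall_specialization c' F fun f hf => hle hf F hF

end genericClosed

/-- Every irreducible closed set has a generic point with coordinates in an algebraically closed
field. -/
theorem exists_eq_genericClosed {N d : ℕ} (Z : IrreducibleCloseds (Forms N d)) :
    ∃ (Ω : Type) (_ : Field Ω) (_ : Algebra ℂ Ω) (_ : IsAlgClosed Ω)
      (c : MonomialOfDegree (Fin (N + 1)) d → Ω), Z = genericClosed c := by
  let R := MvPolynomial (MonomialOfDegree (Fin (N + 1)) d) ℂ
  let P : Ideal R := ⨅ f ∈ (Z : Set (Forms N d)), RingHom.ker (aeval f.coeffs : R →ₐ[ℂ] ℂ)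
  have hP (F : R) : F ∈ P ↔ ∀ f ∈ (Z : Set (Forms N d)), aeval f.coeffs F = 0 := by
    simp only [P, Ideal.mem_iInf, RingHom.mem_ker]
  have hprime : P.IsPrime := by
    refine Ideal.isPrime_iff.2 ⟨fun h => ?_, fun {F G} h => ?_⟩
    · obtain ⟨f, hf⟩ := Z.isIrreducible'.nonempty
      have := (hP 1).1 (h ▸ trivial) f hf
      rw [map_one] at this
      exact one_ne_zero this
    · have := isPreirreducible_iff_isClosed_union_isClosed.1 Z.isIrreducible'.isPreirreducible
        {f | ∀ F' ∈ ({F} : Set R), aeval f.coeffs F' = 0}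
        {f | ∀ F' ∈ ({G} : Set R), aeval f.coeffs F' = 0}
        (Forms.isClosed_iff.2 ⟨_, rfl⟩) (Forms.isClosed_iff.2 ⟨_, rfl⟩) fun f hf => by
          have := (hP _).1 h f hf
          rw [map_mul, mul_eq_zero] at this
          simpa using this
      refine this.imp (fun h => ?_) fun h => ?_
      · exact (hP F).2 fun f hf => h hf F rfl
      · exact (hP G).2 fun f hf => h hf G rfl
  let Ω := AlgebraicClosure (FractionRing (R ⧸ P))
  let φ : R →ₐ[ℂ] Ω := (IsScalarTower.toAlgHom ℂ (FractionRing (R ⧸ P)) Ω).comp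
    ((IsScalarTower.toAlgHom ℂ (R ⧸ P) (FractionRing (R ⧸ P))).comp (Ideal.Quotient.mkₐ ℂ P))
  let c (m : MonomialOfDegree (Fin (N + 1)) d) : Ω := φ (X m)
  have hc (F : R) : aeval c F = 0 ↔ F ∈ P := by
    have : aeval c = φ := by
      ext m
      simp [c]
    rw [this, ← Ideal.Quotient.eq_zero_iff_mem,
      ← map_eq_zero_iff _ (IsFractionRing.injective (R ⧸ P) (FractionRing (R ⧸ P))),
      ← map_eq_zero_iff _ (algebraMap (FractionRing (R ⧸ P)) Ω).injective]
    rfl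
  refine ⟨Ω, inferInstance, inferInstance, inferInstance, c, ?_⟩
  ext f
  change f ∈ (Z : Set (Forms N d)) ↔ ∀ G, aeval c G = 0 → aeval f.coeffs G = 0
  constructor
  · intro hf G hG
    exact (hP G).1 ((hc G).1 hG) f hf
  · intro h
    obtain ⟨S, hS⟩ := Forms.isClosed_iff.1 Z.isClosed'
    change f ∈ Z.carrier
    rw [hS]
    intro F hF
    refine h F ((hc F).2 ((hP F).2 fun g hg => ?_))
    have hg' : g ∈ Z.carrier := hg
    rw [hS] at hg'
    exact hg' F hF

/-! ### The codimension bound -/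

theorem eval₂_optionEquivLeft {R S ι : Type*} [CommRing R] [CommRing S] [Algebra R S] (x : ι → S)
    (a : S) (p : MvPolynomial (Option ι) R) :
    (optionEquivLeft R ι p).eval₂ (aeval x : MvPolynomial ι R →ₐ[R] S).toRingHom a =
      aeval (fun o : Option ι => o.elim a x) p := by
  induction p using MvPolynomial.induction_on with
  | C r =>
    rw [optionEquivLeft_C, Polynomial.eval₂_C, aeval_C]
    exact aeval_C x r
  | add p q hp hq => rw [map_add, Polynomial.eval₂_add, hp, hq, map_add]
  | mul_X p o hp =>
    rw [map_mul, Polynomial.eval₂_mul, hp, map_mul, aeval_X]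
    congr 1
    cases o with
    | none => rw [optionEquivLeft_X_none, Polynomial.eval₂_X]; rfl
    | some i =>
      rw [optionEquivLeft_X_some, Polynomial.eval₂_C]
      exact aeval_X x i

/-- If the coordinates of `c` outside `B` are algebraic over those in `B`, the coheight is at least
the number of coordinates outside `B`: replacing these coordinates by indeterminates one after the
other gives a chain. Algebraicity is expressed by a polynomial `Q` over the polynomial ring in the
coordinates in `B`. -/
theorem card_compl_le_coheight_genericClosed {N d : ℕ} (n : ℕ) : ∀ {L : Type} [CommRing L]
    [IsDomain L] [Algebra ℂ L] (c : MonomialOfDegree (Fin (N + 1)) d → L)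
    (B : Set (MonomialOfDegree (Fin (N + 1)) d)), Bᶜ.ncard = n →
    (∀ i ∉ B, ∃ Q : Polynomial (MvPolynomial B ℂ),
      Q.map (aeval fun b : B => c b : MvPolynomial B ℂ →ₐ[ℂ] L).toRingHom ≠ 0 ∧
      Q.eval₂ (aeval fun b : B => c b : MvPolynomial B ℂ →ₐ[ℂ] L).toRingHom (c i) = 0) →
    (n : ℕ∞) ≤ Order.coheight (genericClosed c) := by
  classical
  induction n with
  | zero => simp
  | succ n ih =>
    intro L _ _ _ c B hn hB
    obtain ⟨i, hi⟩ : (Bᶜ).Nonempty := by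
      rw [← Set.ncard_pos]
      omega
    let c' : MonomialOfDegree (Fin (N + 1)) d → Polynomial L :=
      Function.update (fun m => Polynomial.C (c m)) i Polynomial.X
    have hc' {m} (hm : m ≠ i) : c' m = Polynomial.C (c m) := Function.update_of_ne hm _ _
    have hci : c' i = Polynomial.X := Function.update_self _ _ _
    have hφ : (aeval fun b : B => c' b : MvPolynomial B ℂ →ₐ[ℂ] Polynomial L).toRingHom =
        Polynomial.C.comp (aeval fun b : B => c b : MvPolynomial B ℂ →ₐ[ℂ] L).toRingHom := by
      have : (aeval fun b : B => c' b : MvPolynomial B ℂ →ₐ[ℂ] Polynomial L) =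
          (Polynomial.CAlgHom).comp (aeval fun b : B => c b : MvPolynomial B ℂ →ₐ[ℂ] L) := by
        ext b
        rw [aeval_X, hc' fun h => hi (h ▸ b.2)]
        simp
      rw [this]
      rfl
    have hlt : genericClosed c < genericClosed c' := by
      obtain ⟨Q, hQ, hQ0⟩ := hB i hi
      have hF {S : Type} [CommRing S] [Algebra ℂ S] (x : MonomialOfDegree (Fin (N + 1)) d → S) :
          aeval x (Q.eval₂ (rename Subtype.val : MvPolynomial B ℂ →ₐ[ℂ] _).toRingHom (X i)) =
          Q.eval₂ (aeval fun b : B => x b : MvPolynomial B ℂ →ₐ[ℂ] S).toRingHom (x i) := by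
        have := Polynomial.hom_eval₂ Q (rename Subtype.val : MvPolynomial B ℂ →ₐ[ℂ] _).toRingHom
          (aeval x : MvPolynomial _ ℂ →ₐ[ℂ] S).toRingHom (X i)
        refine this.trans ?_
        congr 1
        · refine RingHom.ext fun p => ?_
          exact aeval_rename _ _ _
        · exact aeval_X x i
      refine genericClosed_lt (F := Q.eval₂
        (rename Subtype.val : MvPolynomial B ℂ →ₐ[ℂ] _).toRingHom (X i)) (fun G hG => ?_) ?_ ?_
      · have : aeval c = ((Polynomial.aeval (c i)).restrictScalars ℂ).comp
            (aeval c' : MvPolynomial _ ℂ →ₐ[ℂ] Polynomial L) := by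
          ext m
          rw [aeval_X, AlgHom.comp_apply, aeval_X]
          by_cases hm : m = i
          · subst hm
            simp [hci]
          · simp [hc' hm]
        rw [this, AlgHom.comp_apply, hG, map_zero]
      · rw [hF, hQ0]
      · rw [hF, hφ, hci, ← Polynomial.eval₂_map, Polynomial.eval₂_C_X]
        exact hQ
    have hB' : ∀ j ∉ insert i B, ∃ Q : Polynomial (MvPolynomial (insert i B : Set _) ℂ),
        Q.map (aeval fun b : (insert i B : Set _) => c' b :
          MvPolynomial (insert i B : Set _) ℂ →ₐ[ℂ] Polynomial L).toRingHom ≠ 0 ∧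
        Q.eval₂ (aeval fun b : (insert i B : Set _) => c' b :
          MvPolynomial (insert i B : Set _) ℂ →ₐ[ℂ] Polynomial L).toRingHom (c' j) = 0 := by
      intro j hj
      obtain ⟨Q, hQ, hQ0⟩ := hB j fun h => hj (Set.mem_insert_of_mem _ h)
      let ρ : MvPolynomial B ℂ →ₐ[ℂ] MvPolynomial (insert i B : Set _) ℂ :=
        rename (Set.inclusion (Set.subset_insert i B))
      have hρ : (aeval fun b : (insert i B : Set _) => c' b :
          MvPolynomial (insert i B : Set _) ℂ →ₐ[ℂ] Polynomial L).toRingHom.comp ρ.toRingHom =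
          Polynomial.C.comp (aeval fun b : B => c b : MvPolynomial B ℂ →ₐ[ℂ] L).toRingHom := by
        rw [← hφ]
        exact RingHom.ext fun p => aeval_rename _ _ _
      refine ⟨Q.map ρ.toRingHom, ?_, ?_⟩
      · rw [Polynomial.map_map, hρ, ← Polynomial.map_map]
        exact (Polynomial.map_ne_zero_iff Polynomial.C_injective).2 hQ
      · rw [Polynomial.eval₂_map, hρ, hc' fun h => hj (h ▸ Set.mem_insert _ _),
          ← Polynomial.hom_eval₂, hQ0, map_zero]
    have hcard : (insert i B)ᶜ.ncard = n := by
      have : (insert i B)ᶜ = Bᶜ \ {i} := by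
        ext; simp [and_comm]
      rw [this, Set.ncard_sdiff_singleton_of_mem hi, hn, Nat.add_sub_cancel]
    rw [Nat.cast_add, Nat.cast_one]
    exact (add_le_add_left (ih c' (insert i B) hcard hB') 1).trans (Order.coheight_add_one_le hlt)

/-- The transcendence degree of the coefficients is at most the dimension of the space of
first-order deformations, since algebraically independent coefficients can be differentiated
independently. -/
theorem ncard_le_finrank_range_derivativeMap {Ω σ : Type} [Field Ω] [Algebra ℂ Ω] [Finite σ]
    {d : ℕ} (c : MonomialOfDegree σ d → Ω) (B : Set (MonomialOfDegree σ d))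
    (hB : AlgebraicIndepOn ℂ c B) :
    B.ncard ≤ Module.finrank Ω (LinearMap.range (derivativeMap ℂ (formOf c))) := by
  classical
  have := Fintype.ofFinite B
  choose D hD using fun b : B => exists_derivation_extension (0 : Derivation ℂ ℂ Ω) hB
    (Pi.single b 1)
  have hfin : FiniteDimensional Ω (LinearMap.range (derivativeMap ℂ (formOf c))) := by
    refine Submodule.finiteDimensional_of_le (S₂ := homogeneousSubmodule σ Ω d) ?_
    rintro _ ⟨D, rfl⟩
    exact isHomogeneous_coeffDerivation _ (isHomogeneous_formOf c)
  let l : LinearMap.range (derivativeMap ℂ (formOf c)) →ₗ[Ω] (B → Ω) :=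
    LinearMap.pi fun b => lcoeff Ω ((b : MonomialOfDegree σ d) : σ →₀ ℕ) ∘ₗ Submodule.subtype _
  have hl : l ∘ (fun b => ⟨derivativeMap ℂ (formOf c) (D b), _, rfl⟩) =
      fun b => Pi.single b (1 : Ω) := by
    funext b
    ext b'
    change coeff ((b' : MonomialOfDegree σ d) : σ →₀ ℕ)
      (coeffDerivation σ (D b) (formOf c)) = _
    rw [coeff_coeffDerivation, coeff_formOf]
    exact (hD b).2 b'
  have hli : LinearIndependent Ω fun b : B => Pi.single b (1 : Ω) :=
    Pi.linearIndependent_single_one B Ω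
  rw [← hl] at hli
  have := (LinearIndependent.of_comp l hli).fintype_card_le_finrank
  rwa [← Nat.card_eq_fintype_card] at this

/-- The generic form of a closed set of forms with infinitely many singular points has itself
infinitely many singular points, so that the bound for its first-order deformations applies. -/
theorem le_coheight_genericClosed {N d : ℕ} (hd : 3 ≤ d) {Ω : Type} [Field Ω] [IsAlgClosed Ω]
    [Algebra ℂ Ω] (c : MonomialOfDegree (Fin (N + 1)) d → Ω)
    (h : (genericClosed c : Set (Forms N d)) ⊆ SingDimGE 1 N d) :
    (((d - 2) * N : ℕ) : ℕ∞) ≤ Order.coheight (genericClosed c) := by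
  -- the generic form has a singular zero on every hyperplane over `ℂ`
  have hsing (l : Fin (N + 1) → ℂ) : ∃ v : Fin (N + 1) → Ω, v ≠ 0 ∧
      (∀ k, aeval v (gradSystem (formOf c) k) = 0) ∧ ∑ i, algebraMap ℂ Ω (l i) * v i = 0 := by
    by_contra! hl
    obtain ⟨r, hr, hr'⟩ := exists_eliminant_gradSystem c l fun v hv hv' => by
      by_contra h0
      exact hl v h0 hv hv'
    refine hr (aeval_eq_zero_of_forall_specialization c r fun f hf => ?_)
    by_contra h0
    obtain ⟨v, hv0, hv, hv'⟩ := (mem_singDimGE_one_iff f).1 (h hf) l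
    exact hv0 (hr' _ h0 v (by rwa [Forms.formOf_coeffs]) hv')
  have hg := isHomogeneous_gradSystem (isHomogeneous_formOf c)
  obtain ⟨j, hj⟩ := exists_infinite_chart (k := ℂ) (gradSystem (formOf c)) _ hg hsing
  obtain ⟨F, _, _, ξ, hξ, s, hs⟩ := exists_nonconstant_zero
    (Ideal.span (insert (X j - 1) (Set.range (gradSystem (formOf c))))) (hj.mono fun v hv => by
      rw [zeroLocus_span]
      rintro _ (rfl | ⟨k, rfl⟩)
      · simp [hv.2]
      · exact hv.1 k)
  have hξg (k) : aeval ξ (gradSystem (formOf c) k) = 0 :=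
    hξ _ (Ideal.subset_span (Set.mem_insert_of_mem _ ⟨k, rfl⟩))
  have hξj : ξ j = 1 := by
    have := hξ _ (Ideal.subset_span (Set.mem_insert _ _))
    rwa [map_sub, map_one, aeval_X, sub_eq_zero] at this
  let _ : Algebra ℂ F := ((algebraMap Ω F).comp (algebraMap ℂ Ω)).toAlgebra
  have : IsScalarTower ℂ Ω F := IsScalarTower.of_algebraMap_eq fun _ => rfl
  have : CharZero Ω := charZero_of_injective_algebraMap (algebraMap ℂ Ω).injective
  have : CharZero F := charZero_of_injective_algebraMap (algebraMap Ω F).injective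
  have hcount := finrank_range_derivativeMap_le (C := ℂ) hd (formOf c) (isHomogeneous_formOf c) ξ
    (hξg none) (fun i => hξg (some i)) hξj hs
  obtain ⟨B, hB⟩ := Set.Finite.exists_maximal
    (Set.toFinite {B : Set (MonomialOfDegree (Fin (N + 1)) d) | AlgebraicIndepOn ℂ c B})
    ⟨∅, algebraicIndependent_empty_type⟩
  have hBind : AlgebraicIndepOn ℂ c B := hB.prop
  have hle := ncard_le_finrank_range_derivativeMap c B hBind
  have hcompl := Set.ncard_add_ncard_compl B
  refine le_trans ?_ (card_compl_le_coheight_genericClosed _ c B rfl fun i hi => ?_)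
  · rw [Fintype.card_fin, Nat.add_sub_cancel, mul_comm N] at hcount
    change _ ≤ Nat.card (MonomialOfDegree (Fin (N + 1)) d) at hcount
    exact_mod_cast (by omega : (d - 2) * N ≤ Bᶜ.ncard)
  · have hnot : ¬ AlgebraicIndependent ℂ fun o : Option B => o.elim (c i) fun b => c b := by
      intro hi'
      have htr := (AlgebraicIndependent.option_iff_transcendental hBind (c i)).1 hi'
      refine hi (hB.le_of_ge (y := insert i B) ((AlgebraicIndepOn.insert_iff hi).2 ⟨hBind, ?_⟩)
        (Set.subset_insert _ _) (Set.mem_insert _ _))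
      rwa [Set.image_eq_range]
    rw [algebraicIndependent_iff] at hnot
    push Not at hnot
    obtain ⟨p, hp, hp0⟩ := hnot
    refine ⟨optionEquivLeft ℂ B p, ?_, ?_⟩
    · rw [Polynomial.map_ne_zero_iff]
      · exact (map_ne_zero_iff _ (optionEquivLeft ℂ B).injective).2 hp0
      · exact hBind
    · rw [eval₂_optionEquivLeft, hp]

theorem theorem0p3 (N d : ℕ) :
    IsClosed (SingDimGE 1 N d) ∧
      (((d - 2) * N : ℕ) : ℕ∞) ≤ topCodim (SingDimGE 1 N d) := by
  refine ⟨isClosed_singDimGE_one N d, le_iInf₂ fun Z hZ => ?_⟩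
  rcases le_or_gt d 2 with hd | hd
  · simp [Nat.sub_eq_zero_of_le hd]
  · obtain ⟨Ω, _, _, _, c, rfl⟩ := exists_eq_genericClosed Z
    exact le_coheight_genericClosed hd c hZ
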